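/- Let $f,g:\mathbb{R}^{d_x}\times\mathbb{R}^{d_y}\to\mathbb{R}$ be twice continuously differentiable, let $g(x,\cdot)$ be $\mu$-strongly convex for every $x$ ($\mu>0$), and let $f$ be $L_{f,0}$-Lipschitz, $\nabla f$ be $L_{f,1}$-Lipschitz, $\nabla g$ be $L_{g,1}$-Lipschitz, and $\nabla_x\nabla_y g$, $\nabla_y\nabla_y g$ be $L_{g,2}$-Lipschitz (Euclidean norm on vectors, operator norm on matrices). Put $y^*(x)=\arg\min_y g(x,y)$ and $\Phi(x)=f(x,y^*(x))$, and assume $\inf_x\Phi(x)>-\infty$. Write $\nabla_vR(x,y,v)=\nabla_y\nabla_yg(x,y)v-\nabla_yf(x,y)$ (the gradient in $v$ of $R(x,y,v)=\tfrac12v^T\nabla_y\nabla_yg(x,y)v-v^T\nabla_yf(x,y)$) and $\bar\nabla f(x,y,v)=\nabla_xf(x,y)-\nabla_x\nabla_yg(x,y)v$. The algorithm S-TFBO starts from $x_0,y_0,v_0$ and $\alpha_0\ge1$, $\beta_0>0$, $\gamma_0>0$, and for $t=0,1,\dots,T-1$ computes $$\beta_{t+1}^2=\beta_t^2+\|\nabla_yg(x_t,y_t)\|^2,\quad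 \gamma_{t+1}^2=\gamma_t^2+\|\nabla_vR(x_t,y_t,v_t)\|^2,\quad \varphi_{t+1}=\max\{\beta_{t+1},\gamma_{t+1}\},\quad \alpha_{t+1}^2=\alpha_t^2+\|\bar\nabla f(x_t,y_t,v_t)\|^2,$$ $$y_{t+1}=y_t-\tfrac1{\beta_{t+1}}\nabla_yg(x_t,y_t),\quad v_{t+1}=v_t-\tfrac1{\varphi_{t+1}}\nabla_vR(x_t,y_t,v_t),\quad x_{t+1}=x_t-\tfrac1{\alpha_{t+1}\varphi_{t+1}}\bar\nabla f(x_t,y_t,v_t),$$ where $\alpha_{t+1},\beta_{t+1},\gamma_{t+1}$ are the positive roots. Then S-TFBO reaches an $\epsilon$-accurate stationary point in $T=\mathcal{O}\big(\frac1\epsilon\log^4\frac1\epsilon\big)$ iterations, with gradient complexity $\mathcal{O}\big(\frac1\epsilon\log^4\frac1\epsilon\big)$. Precisely: let $\mu>0$, $L_{f,0},L_{f,1},L_{g,1},L_{g,2}\ge0$, $\alpha_0\ge1$, $\beta_0>0$, $\gamma_0>0$ and real numbers $\Delta,G$ be given. There are $C>0$ and $\epsilon_0\in(0,1)$, depending only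 on these numbers, such that for every $\epsilon\in(0,\epsilon_0]$ there is an integer $T\ge1$ with $T\le C\,\frac1\epsilon\log^4\frac1\epsilon$ for which the following holds for all dimensions $d_x,d_y$, all $f,g$ as above and all $x_0,y_0,v_0$ with $\Phi(x_0)-\inf\Phi\le\Delta$, $\|\nabla_yg(x_0,y_0)\|\le G$ and $\|\nabla_vR(x_0,y_0,v_0)\|\le G$: 1. $\frac1T\sum_{t=0}^{T-1}\|\nabla\Phi(x_t)\|^2\le\epsilon$; 2. some iterate $x_t$ with $0\le t<T$ is an $\epsilon$-accurate stationary point, that is, $\Phi$ is differentiable at $x_t$ and $\|\nabla\Phi(x_t)\|^2\le\epsilon$; 3. the total number of evaluations of $\nabla_xf$, $\nabla_yf$, $\nabla_yg$ and of products $\nabla_y\nabla_yg(x,y)v$, $\nabla_x\nabla_yg(x,y)v$ made in these $T$ iterations is at most $C\,\frac1\epsilon\log^4\frac1\epsilon$. -/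

import Mathlib

open scoped NNReal InnerProductSpace

noncomputable section

namespace Bilevel

/-- Euclidean space of dimension `n`. -/
abbrev E (n : ℕ) : Type := EuclideanSpace ℝ (Fin n)

variable {dx dy : ℕ}

/-- A map of two vector variables, viewed as a map on the product with the Euclidean norm
`‖(x, y)‖² = ‖x‖² + ‖y‖²`. -/
def joint {F : Type} (h : E dx → E dy → F) : WithLp 2 (E dx × E dy) → F :=
  fun z => h z.fst z.snd

/-- The partial gradient in `x`. -/
def gradX (h : E dx → E dy → ℝ) (x : E dx) (y : E dy) : E dx :=
  gradient (fun x' => h x' y) x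

/-- The partial gradient in `y`. -/
def gradY (h : E dx → E dy → ℝ) (x : E dx) (y : E dy) : E dy :=
  gradient (fun y' => h x y') y

/-- The Hessian in `y`, as a linear operator. -/
def hessYY (h : E dx → E dy → ℝ) (x : E dx) (y : E dy) : E dy →L[ℝ] E dy :=
  fderiv ℝ (fun y' => gradY h x y') y

/-- The mixed second derivative `∇ₓ∇_y h`, the `dx × dy` matrix with entries `∂²h/∂xᵢ∂yⱼ`,
as a linear operator: the transpose of the Jacobian of `x ↦ ∇_y h(x, y)`. -/
def mixedXY (h : E dx → E dy → ℝ) (x : E dx) (y : E dy) : E dy →L[ℝ] E dx :=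
  ContinuousLinearMap.adjoint (fderiv ℝ (fun x' => gradY h x' y) x)

/-- The lower-level solution `y*(x)`, a minimizer of `g(x, ·)`. -/
def yStar (g : E dx → E dy → ℝ) (x : E dx) : E dy :=
  Classical.epsilon (fun y => ∀ y', g x y ≤ g x y')

/-- The upper-level objective `Φ(x) = f(x, y*(x))`. -/
def Phi (f g : E dx → E dy → ℝ) (x : E dx) : ℝ := f x (yStar g x)

/-- The quadratic objective of the linear system,
`R(x, y, v) = ½ vᵀ ∇_y∇_y g(x, y) v - vᵀ ∇_y f(x, y)`. -/
def linObj (f g : E dx → E dy → ℝ) (x : E dx) (y v : E dy) : ℝ :=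
  1 / 2 * ⟪v, hessYY g x y v⟫_ℝ - ⟪v, gradY f x y⟫_ℝ

/-- The gradient of `R(x, y, ·)` at `v`. -/
def gradVR (f g : E dx → E dy → ℝ) (x : E dx) (y v : E dy) : E dy :=
  gradient (fun v' => linObj f g x y v') v

/-- The standing assumptions on the upper-level function `f` and the lower-level function `g`. -/
structure Assumptions (μ : ℝ) (Lf0 Lf1 Lg1 Lg2 : ℝ≥0) (f g : E dx → E dy → ℝ) : Prop where
  contDiff_f : ContDiff ℝ 2 (joint f)
  contDiff_g : ContDiff ℝ 2 (joint g)
  strongConvex : ∀ x, StrongConvexOn Set.univ μ (fun y => g x y)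
  lip_f : LipschitzWith Lf0 (joint f)
  lip_grad_f : LipschitzWith Lf1 (gradient (joint f))
  lip_grad_g : LipschitzWith Lg1 (gradient (joint g))
  lip_mixed_g : LipschitzWith Lg2 (joint (mixedXY g))
  lip_hess_g : LipschitzWith Lg2 (joint (hessYY g))
  bddBelow : BddBelow (Set.range (Phi f g))

/-- `x` is an `ε`-accurate stationary point of `Φ`. -/
def IsAccurate (f g : E dx → E dy → ℝ) (ε : ℝ) (x : E dx) : Prop :=
  DifferentiableAt ℝ (Phi f g) x ∧ ‖gradient (Phi f g) x‖ ^ 2 ≤ ε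

/-- Programs with access to `f` and `g` only through first-order queries: the partial gradients
`∇ₓf`, `∇_y f`, `∇_y g` at a point, and the Hessian-vector and Jacobian-vector products
`∇_y∇_y g(x, y) v` and `∇ₓ∇_y g(x, y) v`. -/
inductive Prog (dx dy : ℕ) (A : Type) : Type where
  | ret (a : A)
  | askGradXf (x : E dx) (y : E dy) (k : E dx → Prog dx dy A)
  | askGradYf (x : E dx) (y : E dy) (k : E dy → Prog dx dy A)
  | askGradYg (x : E dx) (y : E dy) (k : E dy → Prog dx dy A)
  | askHessVec (x : E dx) (y v : E dy) (k : E dy → Prog dx dy A)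
  | askMixedVec (x : E dx) (y v : E dy) (k : E dx → Prog dx dy A)

namespace Prog

variable {A B : Type}

/-- Sequential composition. -/
def bind : Prog dx dy A → (A → Prog dx dy B) → Prog dx dy B
  | ret a, c => c a
  | askGradXf x y k, c => askGradXf x y (fun w => bind (k w) c)
  | askGradYf x y k, c => askGradYf x y (fun w => bind (k w) c)
  | askGradYg x y k, c => askGradYg x y (fun w => bind (k w) c)
  | askHessVec x y v k, c => askHessVec x y v (fun w => bind (k w) c)
  | askMixedVec x y v k, c => askMixedVec x y v (fun w => bind (k w) c)

/-- The result of a program when the queries are answered for `f` and `g`. -/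
def eval (f g : E dx → E dy → ℝ) : Prog dx dy A → A
  | ret a => a
  | askGradXf x y k => eval f g (k (gradX f x y))
  | askGradYf x y k => eval f g (k (gradY f x y))
  | askGradYg x y k => eval f g (k (gradY g x y))
  | askHessVec x y v k => eval f g (k (hessYY g x y v))
  | askMixedVec x y v k => eval f g (k (mixedXY g x y v))

/-- The number of queries made by a program when the queries are answered for `f` and `g`. -/
def cost (f g : E dx → E dy → ℝ) : Prog dx dy A → ℕ
  | ret _ => 0
  | askGradXf x y k => cost f g (k (gradX f x y)) + 1
  | askGradYf x y k => cost f g (k (gradY f x y)) + 1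
  | askGradYg x y k => cost f g (k (gradY g x y)) + 1
  | askHessVec x y v k => cost f g (k (hessYY g x y v)) + 1
  | askMixedVec x y v k => cost f g (k (mixedXY g x y v)) + 1

theorem eval_bind (f g : E dx → E dy → ℝ) (p : Prog dx dy A) (c : A → Prog dx dy B) :
    (p.bind c).eval f g = (c (p.eval f g)).eval f g := by
  induction p with
  | ret a => rfl
  | _ => simp_all [bind, eval]

theorem cost_bind (f g : E dx → E dy → ℝ) (p : Prog dx dy A) (c : A → Prog dx dy B) :
    (p.bind c).cost f g = p.cost f g + (c (p.eval f g)).cost f g := by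
  induction p with
  | ret a => simp [bind, eval, cost]
  | _ => simp_all [bind, eval, cost]; try omega

end Prog

/-- The variables of the single-loop algorithm. -/
structure State (dx dy : ℕ) : Type where
  x : E dx
  y : E dy
  v : E dy
  α : ℝ
  β : ℝ
  γ : ℝ

/-- The update of one iteration, from the state and the values `gy = ∇_y g(x, y)`,
`gv = ∇_v R(x, y, v)` and `gx = ∇̄f(x, y, v)`. -/
def update (s : State dx dy) (gy gv : E dy) (gx : E dx) : State dx dy :=
  let β' := √(s.β ^ 2 + ‖gy‖ ^ 2)
  let γ' := √(s.γ ^ 2 + ‖gv‖ ^ 2)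
  let φ' := max β' γ'
  let α' := √(s.α ^ 2 + ‖gx‖ ^ 2)
  { x := s.x - (1 / (α' * φ')) • gx
    y := s.y - (1 / β') • gy
    v := s.v - (1 / φ') • gv
    α := α'
    β := β'
    γ := γ' }

/-- One iteration, with `∇_v R(x, y, v) = ∇_y∇_y g(x, y) v - ∇_y f(x, y)` and
`∇̄f(x, y, v) = ∇ₓf(x, y) - ∇ₓ∇_y g(x, y) v` computed from queries. -/
def iteration (s : State dx dy) : Prog dx dy (State dx dy) :=
  .askGradYg s.x s.y fun gy =>
  .askHessVec s.x s.y s.v fun hv =>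
  .askGradYf s.x s.y fun fy =>
  .askGradXf s.x s.y fun fx =>
  .askMixedVec s.x s.y s.v fun jv =>
  .ret (update s gy (hv - fy) (fx - jv))

/-- S-TFBO: `T` iterations from the initial state `s₀`. -/
def stfbo (s₀ : State dx dy) : ℕ → Prog dx dy (State dx dy)
  | 0 => .ret s₀
  | T + 1 => (stfbo s₀ T).bind iteration

/-- The state reached by S-TFBO after `t` iterations. -/
def iterate (f g : E dx → E dy → ℝ) (s₀ : State dx dy) (t : ℕ) : State dx dy :=
  (stfbo s₀ t).eval f g

/-- The number of gradient evaluations, Hessian-vector and Jacobian-vector products included,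
made by S-TFBO in `T` iterations. -/
def gradCount (f g : E dx → E dy → ℝ) (s₀ : State dx dy) (T : ℕ) : ℕ :=
  (stfbo s₀ T).cost f g

theorem gradVR_eq {f g : E dx → E dy → ℝ} (hg : ContDiff ℝ 2 (joint g)) (x : E dx)
    (y v : E dy) : gradVR f g x y v = hessYY g x y v - gradY f x y := by
  have hG : ContDiff ℝ 2 (fun y' => g x y') := by
    have : ContDiff ℝ 2 (fun y' : E dy => (WithLp.toLp 2 (x, y') : WithLp 2 (E dx × E dy))) :=
      (WithLp.prodContinuousLinearEquiv 2 ℝ (E dx) (E dy)).symm.contDiff.comp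
        (contDiff_const.prodMk contDiff_id)
    exact hg.comp this
  have hd : Differentiable ℝ (fderiv ℝ (fun y' => g x y')) :=
    (hG.fderiv_right (m := 1) (by norm_num)).differentiable (by norm_num)
  have hin : ∀ u w : E dy, ⟪hessYY g x y u, w⟫_ℝ =
      fderiv ℝ (fderiv ℝ (fun y' => g x y')) y u w := by
    intro u w
    let J : StrongDual ℝ (E dy) →L[ℝ] E dy := LinearMap.toContinuousLinearMap
      { toFun := (InnerProductSpace.toDual ℝ (E dy)).symm
        map_add' := fun a b => map_add _ a b
        map_smul' := fun c a => by simp }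
    have h1 : HasFDerivAt (fun y' => gradY g x y')
        (J.comp (fderiv ℝ (fderiv ℝ (fun y' => g x y')) y)) y :=
      J.hasFDerivAt.comp y (hd y).hasFDerivAt
    rw [hessYY, h1.fderiv]
    exact InnerProductSpace.toDual_symm_apply
  have hsymm : ∀ u w : E dy, ⟪hessYY g x y u, w⟫_ℝ = ⟪hessYY g x y w, u⟫_ℝ := by
    intro u w
    rw [hin, hin]
    exact (hG.contDiffAt.isSymmSndFDerivAt (by simp)) u w
  apply HasGradientAt.gradient
  rw [hasGradientAt_iff_hasFDerivAt]
  have h2 := (((hasFDerivAt_id v).inner ℝ (hessYY g x y).hasFDerivAt).const_mul (1 / 2 : ℝ)).sub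
    ((hasFDerivAt_id v).inner ℝ (hasFDerivAt_const (gradY f x y) v))
  refine h2.congr_fderiv ?_
  ext w
  have hs := hsymm v w
  have h3 := real_inner_comm v (hessYY g x y w)
  have h4 := real_inner_comm w (hessYY g x y v)
  have h5 := real_inner_comm w (gradY f x y)
  simp [fderivInnerCLM_apply]
  linarith

theorem iterate_succ {f g : E dx → E dy → ℝ} (hg : ContDiff ℝ 2 (joint g))
    (s₀ : State dx dy) (t : ℕ) :
    iterate f g s₀ (t + 1) =
      let s := iterate f g s₀ t
      update s (gradY g s.x s.y) (gradVR f g s.x s.y s.v)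
        (gradX f s.x s.y - mixedXY g s.x s.y s.v) := by
  simp only [gradVR_eq hg]
  exact Prog.eval_bind f g _ _

end Bilevel

end

/-! Along the iteration the squared hypergradient norms are summable, with a bound depending only on
the given constants. The average over `T` steps is then O(1/T), so T = O(1/ε) already suffices, and
the factor log⁴(1/ε) is only slack.

Write P, R, X for the squared norms of ∇_y g, ∇_v R and ∇̄f at step t, and S for that of ∇Φ. Strong
convexity makes y* and v* Lipschitz in x. One step towards a moving target gives the two tracking
inequalities `yStar_tracking` and `vStar_tracking`: ‖y - y*‖² and ‖v - v*‖² decrease by multiples of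
P/β and R/φ. The errors are P/β² for y, R/φ² and P/φ for v, and a drift term X/(α²φ) for both,
caused by the motion of x. `Phi_descent` shows that (S + X)/(αφ) is paid for by the decrease of Φ,
up to (P + R)/(αφ) and X/(α²φ²). Nothing here requires small step sizes.

The rest is a bootstrap on scalar sequences, `exists_sum_le`. Let A be the sum of X/(α²φ). Sums of
P/β² and R/γ² are logarithms of the accumulators (`sum_div_sq_le_log`), while the accumulators grow
at most linearly in the sums of P/β and R/φ. Since a logarithm loses to a linear term, those sums,
and hence φ, are O(1 + A). Descent then bounds the sum of (S + X)/(αφ) by O(1 + A), and so α by O((1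
+ A)²). But A is itself at most a constant times log α, so A ≤ const · (1 + log(1 + A)), which
bounds A and everything else. -/

namespace Bilevel

/-! ### Scalar recursions for the accumulators -/

/-- The logarithm grows more slowly than any linear function, in the form used to solve
self-referential bounds. -/
theorem exists_le_of_le_log (c C B : ℝ) (hc : 0 < c) (hC : 0 < C) (hB : 0 < B) :
    ∃ K : ℝ, 0 < K ∧ ∀ S A : ℝ, 0 ≤ S → 0 ≤ A →
      c * S ≤ C * (1 + A) + C * Real.log (B * (1 + A + S)) → S ≤ K * (1 + A) := by
  refine ⟨2 / c * (C + c / 2 + C * |Real.log (B / (c / (2 * C)))|), by positivity, ?_⟩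
  intro S A hS hA h
  -- With this scale, log u ≤ u - 1 at u = δ(1 + A + S) costs only (c/2)S after multiplication by
  -- `C`, half of the left side.
  set δ := c / (2 * C) with hδ
  have hδ0 : 0 < δ := by positivity
  have h1 : Real.log (B * (1 + A + S)) ≤ Real.log (B / δ) + δ * (1 + A + S) := by
    have : B * (1 + A + S) = (B / δ) * (δ * (1 + A + S)) := by field_simp
    rw [this, Real.log_mul (by positivity) (by positivity)]
    linarith [Real.log_le_sub_one_of_pos (show 0 < δ * (1 + A + S) by positivity)]
  have h2 : C * Real.log (B * (1 + A + S)) ≤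
      C * |Real.log (B / δ)| * (1 + A) + c / 2 * (1 + A + S) := by
    have h3 : C * (δ * (1 + A + S)) = c / 2 * (1 + A + S) := by rw [hδ]; field_simp
    have h4 : Real.log (B / δ) ≤ |Real.log (B / δ)| * (1 + A) :=
      (le_abs_self _).trans (le_mul_of_one_le_right (abs_nonneg _) (by linarith))
    nlinarith [mul_le_mul_of_nonneg_left h1 hC.le, mul_le_mul_of_nonneg_left h4 hC.le]
  have h5 : c / 2 * S ≤ (C + c / 2 + C * |Real.log (B / δ)|) * (1 + A) := by linarith
  calc S = 2 / c * (c / 2 * S) := by field_simp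
    _ ≤ 2 / c * ((C + c / 2 + C * |Real.log (B / δ)|) * (1 + A)) := by gcongr
    _ = _ := by ring

theorem accumulator_monotone {a X : ℕ → ℝ} (ha : ∀ t, 0 < a t) (hX : ∀ t, 0 ≤ X t)
    (hrec : ∀ t, a (t + 1) ^ 2 = a t ^ 2 + X t) : Monotone a :=
  monotone_nat_of_le_succ fun t =>
    (sq_le_sq₀ (ha _).le (ha _).le).mp (by rw [hrec]; linarith [hX t])

/-- With q = a_T / a_{T+1}, the new term equals 1 - q² ≤ -log q², and these logarithms telescope. -/
theorem sum_div_sq_le_log {a X : ℕ → ℝ} (ha : ∀ t, 0 < a t)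
    (hrec : ∀ t, a (t + 1) ^ 2 = a t ^ 2 + X t) (T : ℕ) :
    ∑ t ∈ Finset.range T, X t / a (t + 1) ^ 2 ≤ 2 * Real.log (a T / a 0) := by
  induction T with
  | zero => simp [(ha 0).ne']
  | succ T ih =>
    rw [Finset.sum_range_succ]
    have h0 := ha 0
    have h1 := ha T
    have h2 := ha (T + 1)
    have h3 : Real.log (a (T + 1) / a 0) =
        Real.log (a T / a 0) - Real.log (a T / a (T + 1)) := by
      rw [Real.log_div h2.ne' h0.ne', Real.log_div h1.ne' h0.ne', Real.log_div h1.ne' h2.ne']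
      ring
    have h4 := Real.log_le_sub_one_of_pos (show 0 < (a T / a (T + 1)) ^ 2 by positivity)
    rw [Real.log_pow] at h4
    have h5 : X T / a (T + 1) ^ 2 = 1 - (a T / a (T + 1)) ^ 2 := by
      have := hrec T
      rw [div_pow]
      field_simp
      linarith
    push_cast at h4
    linarith

/-- Each increment is X / (a_{T+1} + a_T). The bound turns control of a weighted sum into control of
the accumulator itself. -/
theorem sub_le_sum_div {a X : ℕ → ℝ} (ha : ∀ t, 0 < a t) (hX : ∀ t, 0 ≤ X t)
    (hrec : ∀ t, a (t + 1) ^ 2 = a t ^ 2 + X t) (T : ℕ) :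
    a T - a 0 ≤ ∑ t ∈ Finset.range T, X t / a (t + 1) := by
  induction T with
  | zero => simp
  | succ T ih =>
    rw [Finset.sum_range_succ]
    have h1 := ha T
    have h2 := ha (T + 1)
    have h3 : a (T + 1) - a T ≤ X T / a (T + 1) := by
      rw [le_div_iff₀ h2]
      nlinarith [hrec T, accumulator_monotone ha hX hrec (Nat.le_succ T)]
    linarith

theorem sum_eq_sq_sub_sq {a X : ℕ → ℝ}
    (hrec : ∀ t, a (t + 1) ^ 2 = a t ^ 2 + X t) (T : ℕ) :
    ∑ t ∈ Finset.range T, X t = a T ^ 2 - a 0 ^ 2 := by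
  induction T with
  | zero => simp
  | succ T ih => rw [Finset.sum_range_succ, ih, hrec]; ring

set_option maxHeartbeats 1000000 in
/-- Coupled recursions for accumulated squared gradients force the accumulators, and with them
the sum of `S`, to stay bounded. -/
theorem exists_sum_le (a₀ b₀ g₀ c C : ℝ) (ha₀ : 1 ≤ a₀) (hb₀ : 0 < b₀) (hg₀ : 0 < g₀)
    (hc : 0 < c) (hC : 0 < C) :
    ∃ K : ℝ, 0 < K ∧ ∀ a b g X P R S U V F : ℕ → ℝ,
      a 0 = a₀ → b 0 = b₀ → g 0 = g₀ →
      (∀ t, 0 < a t) → (∀ t, 0 < b t) → (∀ t, 0 < g t) →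
      (∀ t, 0 ≤ X t) → (∀ t, 0 ≤ P t) → (∀ t, 0 ≤ R t) → (∀ t, 0 ≤ S t) →
      (∀ t, a (t + 1) ^ 2 = a t ^ 2 + X t) →
      (∀ t, b (t + 1) ^ 2 = b t ^ 2 + P t) →
      (∀ t, g (t + 1) ^ 2 = g t ^ 2 + R t) →
      (∀ t, c * (P t / b (t + 1)) ≤ U t - U (t + 1) + C * (P t / b (t + 1) ^ 2) +
        C * (X t / (a (t + 1) ^ 2 * max (b (t + 1)) (g (t + 1))))) →
      (∀ t, c * (R t / max (b (t + 1)) (g (t + 1))) ≤ V t - V (t + 1) +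
        C * (R t / max (b (t + 1)) (g (t + 1)) ^ 2) + C * (P t / max (b (t + 1)) (g (t + 1))) +
        C * (X t / (a (t + 1) ^ 2 * max (b (t + 1)) (g (t + 1))))) →
      (∀ t, (S t + X t) / (a (t + 1) * max (b (t + 1)) (g (t + 1))) ≤ 2 * (F t - F (t + 1)) +
        C * ((P t + R t) / (a (t + 1) * max (b (t + 1)) (g (t + 1)))) +
        C * (X t / (a (t + 1) ^ 2 * max (b (t + 1)) (g (t + 1)) ^ 2))) →
      U 0 ≤ C → V 0 ≤ C → (∀ t, 0 ≤ U t) → (∀ t, 0 ≤ V t) → (∀ t, F 0 - F t ≤ C) →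
      ∀ T, ∑ t ∈ Finset.range T, S t ≤ K := by
  -- All constants are chosen before the sequences and the horizon appear, so the final bound is
  -- uniform in them.
  obtain ⟨K₁, hK₁, H₁⟩ := exists_le_of_le_log c (2 * C) (1 + 1 / b₀) hc (by positivity)
    (by positivity)
  obtain ⟨K₂, hK₂, H₂⟩ := exists_le_of_le_log c (2 * C + C * K₁)
    ((1 + b₀ + g₀ + K₁) / g₀) hc (by positivity) (by positivity)
  -- the bounds for the larger accumulator and for the sums of the descent inequality
  set M := b₀ + g₀ + K₁ + K₂ with hM
  set N := 2 * C + C * (K₁ + K₂) + C / b₀ with hN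
  have hM0 : 0 < M := by positivity
  have hN0 : 0 < N := by positivity
  -- Closes the loop: here the unknown is the drift sum `A` itself, with parameter 0.
  obtain ⟨K₃, hK₃, H₃⟩ := exists_le_of_le_log b₀ (4 + 2 * |Real.log (1 + M * N)|) 1 hb₀
    (by positivity) one_pos
  refine ⟨(a₀ + M * N * (1 + K₃) ^ 2) * (M * (1 + K₃)) * (N * (1 + K₃)), by positivity, ?_⟩
  intro a b g X P R S U V F ha0 hb0 hg0 ha hb hg hX hP hR hS hra hrb hrg hU hV hF hU0 hV0
    hUn hVn hFn T
  set φ : ℕ → ℝ := fun t => max (b t) (g t) with hφ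
  have hma := accumulator_monotone ha hX hra
  have hmb := accumulator_monotone hb hP hrb
  have hmg := accumulator_monotone hg hR hrg
  have hmφ : Monotone φ := hmb.max hmg
  have hbφ : ∀ t, b t ≤ φ t := fun t => le_max_left _ _
  have hgφ : ∀ t, g t ≤ φ t := fun t => le_max_right _ _
  have hφ0 : ∀ t, 0 < φ t := fun t => (hb t).trans_le (hbφ t)
  have hb0φ : ∀ t, b₀ ≤ φ t := fun t => hb0 ▸ (hmb (Nat.zero_le t)).trans (hbφ t)
  have ha1 : ∀ t, 1 ≤ a t := fun t => ha₀.trans (ha0 ▸ hma (Nat.zero_le t))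
  set SP := ∑ t ∈ Finset.range T, P t / b (t + 1) with hSP
  set SR := ∑ t ∈ Finset.range T, R t / φ (t + 1) with hSR
  set A := ∑ t ∈ Finset.range T, X t / (a (t + 1) ^ 2 * φ (t + 1)) with hA
  set SX := ∑ t ∈ Finset.range T, (S t + X t) / (a (t + 1) * φ (t + 1)) with hSX
  have hSP0 : 0 ≤ SP := Finset.sum_nonneg fun t _ => div_nonneg (hP t) (hb _).le
  have hSR0 : 0 ≤ SR := Finset.sum_nonneg fun t _ => div_nonneg (hR t) (hφ0 _).le
  have hA0 : 0 ≤ A := Finset.sum_nonneg fun t _ =>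
    div_nonneg (hX t) (mul_nonneg (sq_nonneg _) (hφ0 _).le)
  have hSX0 : 0 ≤ SX := Finset.sum_nonneg fun t _ =>
    div_nonneg (add_nonneg (hS t) (hX t)) (mul_nonneg (ha _).le (hφ0 _).le)
  have e1 : c * SP ≤ C + C * (2 * Real.log (b T / b₀)) + C * A := by
    have h := Finset.sum_le_sum fun t (_ : t ∈ Finset.range T) => hU t
    simp only [Finset.sum_add_distrib, ← Finset.mul_sum, Finset.sum_range_sub'] at h
    have h2 := sum_div_sq_le_log hb hrb T
    rw [hb0] at h2
    have h3 := mul_le_mul_of_nonneg_left h2 hC.le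
    linarith [hUn T]
  have e2 : c * SR ≤ C + C * (2 * Real.log (g T / g₀)) + C * SP + C * A := by
    have h := Finset.sum_le_sum fun t (_ : t ∈ Finset.range T) => hV t
    simp only [Finset.sum_add_distrib, ← Finset.mul_sum, Finset.sum_range_sub'] at h
    have h2 := sum_div_sq_le_log hg hrg T
    rw [hg0] at h2
    -- The logarithmic bound needs the accumulator that collects R, so φ is lowered to g in the
    -- denominator.
    have h3 : ∑ t ∈ Finset.range T, R t / φ (t + 1) ^ 2 ≤
        ∑ t ∈ Finset.range T, R t / g (t + 1) ^ 2 := by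
      refine Finset.sum_le_sum fun t _ => ?_
      have := hR t; have := hg (t + 1); have := hgφ (t + 1)
      gcongr
    have h4 : ∑ t ∈ Finset.range T, P t / φ (t + 1) ≤ SP := by
      refine Finset.sum_le_sum fun t _ => ?_
      have := hP t; have := hb (t + 1); have := hbφ (t + 1)
      gcongr
    have h5 := mul_le_mul_of_nonneg_left (h3.trans h2) hC.le
    have h6 := mul_le_mul_of_nonneg_left h4 hC.le
    linarith [hVn T]
  have e3 : SX ≤ 2 * C + C * (SP + SR) + C * (A / b₀) := by
    have h := Finset.sum_le_sum fun t (_ : t ∈ Finset.range T) => hF t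
    simp only [Finset.sum_add_distrib, ← Finset.mul_sum, Finset.sum_range_sub'] at h
    have h3 : ∑ t ∈ Finset.range T, (P t + R t) / (a (t + 1) * φ (t + 1)) ≤ SP + SR := by
      rw [hSP, hSR, ← Finset.sum_add_distrib]
      refine Finset.sum_le_sum fun t _ => ?_
      have h1 := hP t; have h2 := hR t; have h3 := hb (t + 1); have h4 := hbφ (t + 1)
      have h5 := ha1 (t + 1); have h6 := hφ0 (t + 1)
      calc (P t + R t) / (a (t + 1) * φ (t + 1)) ≤ (P t + R t) / φ (t + 1) := by
            gcongr; exact le_mul_of_one_le_left h6.le h5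
        _ = P t / φ (t + 1) + R t / φ (t + 1) := add_div _ _ _
        _ ≤ _ := by gcongr
    have h4 : ∑ t ∈ Finset.range T, X t / (a (t + 1) ^ 2 * φ (t + 1) ^ 2) ≤ A / b₀ := by
      rw [hA, Finset.sum_div]
      refine Finset.sum_le_sum fun t _ => ?_
      have h1 := hX t; have h6 := hφ0 (t + 1); have h7 := ha (t + 1)
      rw [div_div, sq (φ (t + 1)), ← mul_assoc]
      gcongr
      exact hb0φ _
    have h5 := mul_le_mul_of_nonneg_left h3 hC.le
    have h6 := mul_le_mul_of_nonneg_left h4 hC.le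
    linarith [hFn T]
  have e4 : b T ≤ b₀ + SP := by
    have := sub_le_sum_div hb hP hrb T
    linarith
  have e5 : φ T ≤ b₀ + g₀ + SP + SR := by
    rcases le_total (g T) (b T) with h | h
    · have : φ T = b T := max_eq_left h
      linarith
    -- R is weighted by φ rather than by g, so `sub_le_sum_div` does not apply. But at a time when g
    -- attains the maximum, every earlier φ is at most g_T, and Σ R = g_T² - g₀² gives the same
    -- growth bound.
    · have hφT : φ T = g T := max_eq_right h
      have h1 : (g T ^ 2 - g₀ ^ 2) / g T ≤ SR := by
        rw [← hg0, ← sum_eq_sq_sub_sq hrg, Finset.sum_div]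
        refine Finset.sum_le_sum fun t ht => ?_
        have h1 := hR t; have h2 := hφ0 (t + 1)
        have h3 : φ (t + 1) ≤ g T := hφT ▸ hmφ (Finset.mem_range.mp ht)
        gcongr
      have h2 : g T - g₀ ≤ (g T ^ 2 - g₀ ^ 2) / g T := by
        rw [le_div_iff₀ (hg T)]
        have : g₀ ≤ g T := hg0 ▸ hmg (Nat.zero_le T)
        nlinarith only [this, hg₀]
      linarith
  have e6 : SP ≤ K₁ * (1 + A) := by
    refine H₁ SP A hSP0 hA0 (e1.trans ?_)
    have : Real.log (b T / b₀) ≤ Real.log ((1 + 1 / b₀) * (1 + A + SP)) := by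
      apply Real.log_le_log (div_pos (hb T) hb₀)
      rw [div_le_iff₀ hb₀]
      have : (1 + 1 / b₀) * (1 + A + SP) * b₀ = (1 + b₀) * (1 + A + SP) := by
        field_simp; ring
      nlinarith only [this, e4, hA0, hSP0, mul_nonneg hb₀.le hA0, mul_nonneg hb₀.le hSP0]
    linarith only [mul_le_mul_of_nonneg_left this hC.le, mul_nonneg hC.le hA0, hC]
  have e7 : SR ≤ K₂ * (1 + A) := by
    refine H₂ SR A hSR0 hA0 (e2.trans ?_)
    have hgT : g T / g₀ ≤ (1 + b₀ + g₀ + K₁) / g₀ * (1 + A + SR) := by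
      rw [div_mul_eq_mul_div]
      gcongr
      have := hgφ T
      linarith only [this, e5, e6, hA0, mul_nonneg hb₀.le hA0, mul_nonneg hg₀.le hA0,
        mul_nonneg hb₀.le hSR0, mul_nonneg hg₀.le hSR0, mul_nonneg hK₁.le hSR0]
    have hl := Real.log_le_log (div_pos (hg T) hg₀) hgT
    have hl0 : 0 ≤ Real.log (g T / g₀) := by
      apply Real.log_nonneg
      rw [le_div_iff₀ hg₀, one_mul]
      exact hg0 ▸ hmg (Nat.zero_le T)
    have h3 := mul_le_mul_of_nonneg_left e6 hC.le
    have h4 := mul_nonneg hC.le hA0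
    generalize Real.log (g T / g₀) = l at hl hl0 ⊢
    generalize Real.log ((1 + b₀ + g₀ + K₁) / g₀ * (1 + A + SR)) = l' at hl ⊢
    have h1 := mul_le_mul_of_nonneg_left hl hC.le
    have h2 := mul_nonneg (mul_nonneg hC.le hK₁.le) (hl0.trans hl)
    linarith only [h1, h2, h3, h4, hC]
  have e8 : φ T ≤ M * (1 + A) := by
    rw [hM]
    linarith only [e5, e6, e7, mul_nonneg hb₀.le hA0, mul_nonneg hg₀.le hA0]
  have e9 : SX ≤ N * (1 + A) := by
    have h3 := mul_le_mul_of_nonneg_left (add_le_add e6 e7) hC.le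
    have h4 : C * (A / b₀) = C / b₀ * A := by ring
    have h5 : 0 < C / b₀ := by positivity
    rw [hN]
    linarith only [e3, h3, h4, h5, mul_nonneg hC.le hA0]
  have e10 : a T ≤ a₀ + M * N * (1 + A) ^ 2 := by
    have h1 := sub_le_sum_div ha hX hra T
    -- Removing φ from the weights of the descent sum costs at most the final φ, by monotonicity.
    have h2 : ∑ t ∈ Finset.range T, X t / a (t + 1) ≤ φ T * SX := by
      rw [hSX, Finset.mul_sum]
      refine Finset.sum_le_sum fun t ht => ?_
      have h3 : φ (t + 1) ≤ φ T := hmφ (Finset.mem_range.mp ht)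
      have h4 := hX t; have h5 := hS t; have h6 := ha (t + 1); have h7 := hφ0 (t + 1)
      calc X t / a (t + 1) ≤ (S t + X t) / a (t + 1) := by gcongr; linarith
        _ = φ (t + 1) * ((S t + X t) / (a (t + 1) * φ (t + 1))) := by field_simp
        _ ≤ _ := by gcongr
    have h3 : φ T * SX ≤ (M * (1 + A)) * (N * (1 + A)) := by gcongr
    rw [ha0] at h1
    linarith only [h1, h2, h3]
  have e11 : A ≤ K₃ := by
    have h := H₃ A 0 hA0 le_rfl ?_
    · simpa using h
    -- As φ ≥ b₀, the drift sum is dominated by Σ X/a², which is logarithmic in `a T`. That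
    -- accumulator is already polynomial in 1 + A.
    have h1 : b₀ * A ≤ 2 * Real.log (a T / a₀) := by
      rw [← ha0]
      refine le_trans ?_ (sum_div_sq_le_log ha hra T)
      rw [hA, Finset.mul_sum]
      refine Finset.sum_le_sum fun t _ => ?_
      have h4 := hX t; have h6 := ha (t + 1); have h7 := hφ0 (t + 1)
      have h8 : b₀ / φ (t + 1) ≤ 1 := (div_le_one h7).mpr (hb0φ _)
      calc b₀ * (X t / (a (t + 1) ^ 2 * φ (t + 1)))
          = X t / a (t + 1) ^ 2 * (b₀ / φ (t + 1)) := by field_simp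
        _ ≤ X t / a (t + 1) ^ 2 := mul_le_of_le_one_right (by positivity) h8
    have h2 : a T / a₀ ≤ (1 + M * N) * (1 + A) ^ 2 := by
      rw [div_le_iff₀ (by linarith)]
      have h3 : 1 ≤ (1 + A) ^ 2 := one_le_pow₀ (by linarith)
      have h4 : 0 ≤ M * N * (1 + A) ^ 2 := by positivity
      nlinarith only [e10, h3, h4, ha₀]
    have h3 := Real.log_le_log (div_pos (ha T) (by linarith)) h2
    rw [Real.log_mul (by positivity) (by positivity), Real.log_pow] at h3
    have h4 : 0 ≤ Real.log (1 + A) := Real.log_nonneg (by linarith)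
    have h5 : Real.log (1 + M * N) ≤ |Real.log (1 + M * N)| := le_abs_self _
    have h6 : 0 ≤ |Real.log (1 + M * N)| := abs_nonneg _
    push_cast at h3
    rw [one_mul, add_zero]
    nlinarith only [h1, h3, h4, h5, h6, hA0, mul_nonneg h6 h4, mul_nonneg h6 hA0]
  have e12 : ∑ t ∈ Finset.range T, S t ≤ a T * φ T * SX := by
    rw [hSX, Finset.mul_sum]
    refine Finset.sum_le_sum fun t ht => ?_
    have h3 : φ (t + 1) ≤ φ T := hmφ (Finset.mem_range.mp ht)
    have h3' : a (t + 1) ≤ a T := hma (Finset.mem_range.mp ht)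
    have h4 := hX t; have h5 := hS t; have h6 := ha (t + 1); have h7 := hφ0 (t + 1)
    calc S t ≤ S t + X t := by linarith
      _ = a (t + 1) * φ (t + 1) * ((S t + X t) / (a (t + 1) * φ (t + 1))) := by field_simp
      _ ≤ _ := by have := ha T; gcongr
  refine e12.trans ?_
  have h6 := (ha T).le; have h7 := (hφ0 T).le
  have f1 : a T ≤ a₀ + M * N * (1 + K₃) ^ 2 := e10.trans (by gcongr)
  have f2 : φ T ≤ M * (1 + K₃) := e8.trans (by gcongr)
  have f3 : SX ≤ N * (1 + K₃) := e9.trans (by gcongr)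
  have : 0 ≤ a₀ := by linarith
  gcongr

/-! ### Smoothness and strong convexity -/

/-- First-order expansion with a quadratic remainder, from a Lipschitz bound on the derivative. -/
theorem norm_sub_sub_le_of_lipschitz_fderiv {V : Type*} [NormedAddCommGroup V] [NormedSpace ℝ V]
    {K : V → ℝ} {K' : V → V →L[ℝ] ℝ} {L : ℝ} (hL : 0 ≤ L) (hK : ∀ z, HasFDerivAt K (K' z) z)
    (hK' : ∀ z z', ‖K' z' - K' z‖ ≤ L * ‖z' - z‖) (z z' : V) :
    |K z' - K z - K' z (z' - z)| ≤ L * ‖z' - z‖ ^ 2 := by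
  have h := (convex_closedBall z ‖z' - z‖).norm_image_sub_le_of_norm_hasFDerivWithin_le'
    (f := K) (f' := K') (φ := K' z) (C := L * ‖z' - z‖) (x := z) (y := z')
    (fun w _ => (hK w).hasFDerivWithinAt)
    (fun w hw => (hK' z w).trans (by
      rw [mem_closedBall_iff_norm] at hw
      gcongr))
    (by simp) (mem_closedBall_iff_norm.mpr le_rfl)
  rw [Real.norm_eq_abs] at h
  linarith

/-- A strongly convex function lies above the quadratics built on its tangent planes. -/
theorem strongConvexOn_tangent_le {V : Type*} [NormedAddCommGroup V] [InnerProductSpace ℝ V]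
    [CompleteSpace V] {m : ℝ} {h : V → ℝ} (hh : StrongConvexOn Set.univ m h)
    (hd : Differentiable ℝ h) (y y' : V) :
    h y + ⟪gradient h y, y' - y⟫_ℝ + m / 2 * ‖y' - y‖ ^ 2 ≤ h y' := by
  have h1 : HasDerivAt (fun t : ℝ => h (y + t • (y' - y))) ⟪gradient h y, y' - y⟫_ℝ 0 := by
    have h2 : HasDerivAt (fun t : ℝ => y + t • (y' - y)) (y' - y) 0 := by
      simpa using ((hasDerivAt_id (0 : ℝ)).smul_const (y' - y)).const_add y
    have h3 : HasFDerivAt h (fderiv ℝ h y) (y + (0 : ℝ) • (y' - y)) := by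
      simpa using (hd y).hasFDerivAt
    rw [inner_gradient_left]
    exact h3.comp_hasDerivAt 0 h2
  have h4 : Filter.Tendsto (fun t : ℝ => h y' - h y - (1 - t) * (m / 2 * ‖y' - y‖ ^ 2))
      (nhdsWithin 0 (Set.Ioi 0)) (nhds (h y' - h y - (1 - 0) * (m / 2 * ‖y' - y‖ ^ 2))) := by
    refine Filter.Tendsto.mono_left ?_ nhdsWithin_le_nhds
    exact Continuous.tendsto (by fun_prop) 0
  -- Strong convexity on the segment, divided by t, bounds the difference quotient. Letting t
  -- decrease to 0 yields the tangent inequality.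
  have h5 := le_of_tendsto_of_tendsto h1.tendsto_slope_zero_right h4 (by
    filter_upwards [Ioo_mem_nhdsGT (show (0 : ℝ) < 1 by norm_num)] with t ht
    have h6 := hh.2 (Set.mem_univ y) (Set.mem_univ y') (show 0 ≤ 1 - t by linarith [ht.2])
      ht.1.le (by ring)
    have h7 : (1 - t) • y + t • y' = y + t • (y' - y) := by module
    rw [h7] at h6
    simp only [zero_add, zero_smul, add_zero, smul_eq_mul] at h6 ⊢
    rw [norm_sub_rev] at h6
    rw [inv_mul_le_iff₀ ht.1]
    nlinarith)
  linarith

/-- The sum of the tangent inequalities based at the two points. -/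
theorem strongConvexOn_gradient_monotone {V : Type*} [NormedAddCommGroup V]
    [InnerProductSpace ℝ V] [CompleteSpace V] {m : ℝ} {h : V → ℝ}
    (hh : StrongConvexOn Set.univ m h) (hd : Differentiable ℝ h) (y y' : V) :
    m * ‖y - y'‖ ^ 2 ≤ ⟪gradient h y - gradient h y', y - y'⟫_ℝ := by
  have h1 := strongConvexOn_tangent_le hh hd y y'
  have h2 := strongConvexOn_tangent_le hh hd y' y
  have h3 : ⟪gradient h y, y' - y⟫_ℝ = -⟪gradient h y, y - y'⟫_ℝ := by
    rw [← inner_neg_right, neg_sub]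
  rw [inner_sub_left]
  rw [norm_sub_rev y' y] at h1
  linarith

/-- A differentiable strongly convex function on a finite-dimensional space has a minimizer. -/
theorem exists_minimizer_of_strongConvexOn {V : Type*} [NormedAddCommGroup V]
    [InnerProductSpace ℝ V] [CompleteSpace V] [ProperSpace V] {m : ℝ} (hm : 0 < m) {h : V → ℝ}
    (hh : StrongConvexOn Set.univ m h) (hd : Differentiable ℝ h) :
    ∃ y, ∀ y', h y ≤ h y' := by
  refine hd.continuous.exists_forall_le' 0 ?_
  -- Beyond this radius the quadratic term of the tangent bound at 0 dominates the linear one, so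
  -- h(y) ≥ h(0).
  filter_upwards [(tendsto_norm_cocompact_atTop (E := V)).eventually_ge_atTop
    (2 * ‖gradient h 0‖ / m)] with y hy
  have h1 := strongConvexOn_tangent_le hh hd 0 y
  rw [sub_zero] at h1
  have h2 := neg_le_of_abs_le (abs_real_inner_le_norm (gradient h 0) y)
  rw [div_le_iff₀ hm] at hy
  nlinarith [norm_nonneg y]

/-! ### Partial derivatives on the Euclidean product -/

theorem norm_toLp_le {V W : Type*} [NormedAddCommGroup V] [NormedAddCommGroup W]
    (u : V) (q : W) : ‖(WithLp.toLp 2 (u, q) : WithLp 2 (V × W))‖ ≤ ‖u‖ + ‖q‖ := by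
  have h := WithLp.prod_norm_sq_eq_of_L2 (WithLp.toLp 2 (u, q) : WithLp 2 (V × W))
  simp only [WithLp.toLp_fst, WithLp.toLp_snd] at h
  nlinarith [norm_nonneg u, norm_nonneg q,
    norm_nonneg (WithLp.toLp 2 (u, q) : WithLp 2 (V × W))]

theorem norm_toLp_sub_snd {V W : Type*} [NormedAddCommGroup V] [NormedAddCommGroup W]
    (x : V) (y y' : W) :
    ‖(WithLp.toLp 2 (x, y) - WithLp.toLp 2 (x, y') : WithLp 2 (V × W))‖ = ‖y - y'‖ := by
  rw [← WithLp.toLp_sub, Prod.mk_sub_mk, sub_self, WithLp.norm_toLp_snd]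

theorem norm_toLp_sub_fst {V W : Type*} [NormedAddCommGroup V] [NormedAddCommGroup W]
    (x x' : V) (y : W) :
    ‖(WithLp.toLp 2 (x, y) - WithLp.toLp 2 (x', y) : WithLp 2 (V × W))‖ = ‖x - x'‖ := by
  rw [← WithLp.toLp_sub, Prod.mk_sub_mk, sub_self, WithLp.norm_toLp_fst]

theorem norm_toLp_sub_le {V W : Type*} [NormedAddCommGroup V] [NormedAddCommGroup W]
    (x x' : V) (y y' : W) :
    ‖(WithLp.toLp 2 (x, y) - WithLp.toLp 2 (x', y') : WithLp 2 (V × W))‖ ≤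
      ‖x - x'‖ + ‖y - y'‖ := by
  rw [← WithLp.toLp_sub, Prod.mk_sub_mk]
  exact norm_toLp_le _ _

section Inclusions

variable {dx dy : ℕ}

/-- The inclusion of the first factor. -/
def inclX (dx dy : ℕ) : E dx →L[ℝ] WithLp 2 (E dx × E dy) :=
  (WithLp.prodContinuousLinearEquiv 2 ℝ (E dx) (E dy)).symm.toContinuousLinearMap.comp
    (ContinuousLinearMap.inl ℝ (E dx) (E dy))

/-- The inclusion of the second factor. -/
def inclY (dx dy : ℕ) : E dy →L[ℝ] WithLp 2 (E dx × E dy) :=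
  (WithLp.prodContinuousLinearEquiv 2 ℝ (E dx) (E dy)).symm.toContinuousLinearMap.comp
    (ContinuousLinearMap.inr ℝ (E dx) (E dy))

theorem inclX_apply (u : E dx) : inclX dx dy u = WithLp.toLp 2 (u, 0) := rfl

theorem inclY_apply (q : E dy) : inclY dx dy q = WithLp.toLp 2 (0, q) := rfl

theorem hasFDerivAt_toLp_fst (x : E dx) (y : E dy) :
    HasFDerivAt (fun x' : E dx => (WithLp.toLp 2 (x', y) : WithLp 2 (E dx × E dy)))
      (inclX dx dy) x := by
  have h := (inclX dx dy).hasFDerivAt (x := x) |>.add_const (WithLp.toLp 2 (0, y))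
  refine h.congr_of_eventuallyEq (Filter.Eventually.of_forall fun x' => ?_)
  simp [inclX_apply, ← WithLp.toLp_add]

theorem hasFDerivAt_toLp_snd (x : E dx) (y : E dy) :
    HasFDerivAt (fun y' : E dy => (WithLp.toLp 2 (x, y') : WithLp 2 (E dx × E dy)))
      (inclY dx dy) y := by
  have h := (inclY dx dy).hasFDerivAt (x := y) |>.add_const (WithLp.toLp 2 (x, 0))
  refine h.congr_of_eventuallyEq (Filter.Eventually.of_forall fun x' => ?_)
  simp [inclY_apply, ← WithLp.toLp_add]

theorem hasGradientAt_fst {h : E dx → E dy → ℝ} (hh : Differentiable ℝ (joint h)) (x : E dx)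
    (y : E dy) :
    HasGradientAt (fun x' => h x' y) (gradient (joint h) (WithLp.toLp 2 (x, y))).fst x := by
  rw [hasGradientAt_iff_hasFDerivAt]
  have h1 := (hh (WithLp.toLp 2 (x, y))).hasGradientAt.hasFDerivAt.comp x
    (hasFDerivAt_toLp_fst x y)
  refine h1.congr_fderiv ?_
  ext u
  rw [ContinuousLinearMap.comp_apply, InnerProductSpace.toDual_apply_apply,
    InnerProductSpace.toDual_apply_apply, inclX_apply, WithLp.prod_inner_apply]
  simp

theorem hasGradientAt_snd {h : E dx → E dy → ℝ} (hh : Differentiable ℝ (joint h)) (x : E dx)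
    (y : E dy) :
    HasGradientAt (fun y' => h x y') (gradient (joint h) (WithLp.toLp 2 (x, y))).snd y := by
  rw [hasGradientAt_iff_hasFDerivAt]
  have h1 := (hh (WithLp.toLp 2 (x, y))).hasGradientAt.hasFDerivAt.comp y
    (hasFDerivAt_toLp_snd x y)
  refine h1.congr_fderiv ?_
  ext u
  rw [ContinuousLinearMap.comp_apply, InnerProductSpace.toDual_apply_apply,
    InnerProductSpace.toDual_apply_apply, inclY_apply, WithLp.prod_inner_apply]
  simp

theorem gradX_eq {h : E dx → E dy → ℝ} (hh : Differentiable ℝ (joint h)) (x : E dx) (y : E dy) :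
    gradX h x y = (gradient (joint h) (WithLp.toLp 2 (x, y))).fst :=
  (hasGradientAt_fst hh x y).gradient

theorem gradY_eq {h : E dx → E dy → ℝ} (hh : Differentiable ℝ (joint h)) (x : E dx) (y : E dy) :
    gradY h x y = (gradient (joint h) (WithLp.toLp 2 (x, y))).snd :=
  (hasGradientAt_snd hh x y).gradient

/-- The gradient map of a `C²` function is `C¹`. -/
theorem contDiff_gradY {h : E dx → E dy → ℝ} (hh : ContDiff ℝ 2 (joint h)) :
    ContDiff ℝ 1 (joint (gradY h)) := by
  have h1 : ContDiff ℝ 1 (fderiv ℝ (joint h)) := hh.fderiv_right (m := 1) (by norm_num)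
  have h2 : joint (gradY h) = fun z => WithLp.sndL 2 ℝ (E dx) (E dy)
      ((InnerProductSpace.toDual ℝ (WithLp 2 (E dx × E dy))).symm (fderiv ℝ (joint h) z)) := by
    funext z
    exact gradY_eq (hh.differentiable (by norm_num)) z.fst z.snd
  rw [h2]
  exact (WithLp.sndL 2 ℝ (E dx) (E dy)).contDiff.comp
    ((InnerProductSpace.toDual ℝ (WithLp 2 (E dx × E dy))).symm.contDiff.comp h1)

/-- The derivative of `∇_y h` assembled from its two partial derivatives. -/
theorem fderiv_gradY_apply {h : E dx → E dy → ℝ} (hh : ContDiff ℝ 2 (joint h)) (x : E dx)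
    (y : E dy) (w : WithLp 2 (E dx × E dy)) :
    fderiv ℝ (joint (gradY h)) (WithLp.toLp 2 (x, y)) w =
      fderiv ℝ (fun x' => gradY h x' y) x w.fst + hessYY h x y w.snd := by
  have hd := (contDiff_gradY hh).differentiable (by norm_num) (WithLp.toLp 2 (x, y))
  have h1 := hd.hasFDerivAt.comp x (hasFDerivAt_toLp_fst x y)
  have h2 := hd.hasFDerivAt.comp y (hasFDerivAt_toLp_snd x y)
  change HasFDerivAt (fun x' => gradY h x' y) _ x at h1
  change HasFDerivAt (fun y' => gradY h x y') _ y at h2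
  rw [hessYY, h1.fderiv, h2.fderiv, ContinuousLinearMap.comp_apply,
    ContinuousLinearMap.comp_apply, ← map_add]
  congr 1
  rw [inclX_apply, inclY_apply, ← WithLp.toLp_add, Prod.mk_add_mk, add_zero, zero_add]
  rfl

theorem hasFDerivAt_gradY {h : E dx → E dy → ℝ} (hh : ContDiff ℝ 2 (joint h)) (x : E dx)
    (y : E dy) : HasFDerivAt (fun y' => gradY h x y') (hessYY h x y) y := by
  have hd := (contDiff_gradY hh).differentiable (by norm_num) (WithLp.toLp 2 (x, y))
  have h2 := hd.hasFDerivAt.comp y (hasFDerivAt_toLp_snd x y)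
  exact h2.differentiableAt.hasFDerivAt

/-- The pairing is the second Fréchet derivative of h(x, ·), which is symmetric for C² functions. -/
theorem inner_hessYY_comm {h : E dx → E dy → ℝ} (hh : ContDiff ℝ 2 (joint h)) (x : E dx)
    (y u w : E dy) : ⟪hessYY h x y u, w⟫_ℝ = ⟪hessYY h x y w, u⟫_ℝ := by
  have hG : ContDiff ℝ 2 (fun y' => h x y') := by
    have : ContDiff ℝ 2 (fun y' : E dy => (WithLp.toLp 2 (x, y') : WithLp 2 (E dx × E dy))) :=
      (WithLp.prodContinuousLinearEquiv 2 ℝ (E dx) (E dy)).symm.contDiff.comp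
        (contDiff_const.prodMk contDiff_id)
    exact hh.comp this
  have hin : ∀ u w : E dy, ⟪hessYY h x y u, w⟫_ℝ =
      fderiv ℝ (fderiv ℝ (fun y' => h x y')) y u w := by
    intro u w
    have h1 : HasFDerivAt (fun y' => fderiv ℝ (fun y' => h x y') y' w)
        ((innerSL ℝ w).comp (hessYY h x y)) y := by
      refine ((innerSL ℝ w).hasFDerivAt.comp y (hasFDerivAt_gradY hh x y)).congr_of_eventuallyEq
        (Filter.Eventually.of_forall fun y' => ?_)
      simp [gradY, inner_gradient_right]
    have h2 : HasFDerivAt (fun y' => fderiv ℝ (fun y' => h x y') y' w) _ y :=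
      ((hG.fderiv_right (m := 1) (by norm_num)).differentiable
        (by norm_num) y).hasFDerivAt.clm_apply (hasFDerivAt_const w y)
    have h3 := congrArg (fun D => D u) (h1.unique h2)
    simpa [real_inner_comm] using h3
  rw [hin, hin]
  exact (hG.contDiffAt.isSymmSndFDerivAt (by simp)) u w

end Inclusions

/-! ### The lower-level solution, the linear system and the hypergradient -/

/-- A solution of the linear system `∇_y∇_y g(x, y*(x)) v = ∇_y f(x, y*(x))`. -/
noncomputable def vStar {dx dy : ℕ} (f g : E dx → E dy → ℝ) (x : E dx) : E dy :=
  Classical.epsilon fun v => hessYY g x (yStar g x) v = gradY f x (yStar g x)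

theorem mul_norm_le_of_le_inner {V : Type*} [NormedAddCommGroup V] [InnerProductSpace ℝ V]
    {m : ℝ} {p q : V} (h : m * ‖q‖ ^ 2 ≤ ⟪p, q⟫_ℝ) : m * ‖q‖ ≤ ‖p‖ := by
  rcases (norm_nonneg q).eq_or_lt with h0 | h0
  · rw [← h0]; simp
  · refine le_of_mul_le_mul_right ?_ h0
    have := real_inner_le_norm p q
    nlinarith

namespace Assumptions

variable {dx dy : ℕ} {μ : ℝ} {Lf0 Lf1 Lg1 Lg2 : ℝ≥0} {f g : E dx → E dy → ℝ}

theorem differentiable_f (hA : Assumptions μ Lf0 Lf1 Lg1 Lg2 f g) :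
    Differentiable ℝ (joint f) := hA.contDiff_f.differentiable (by norm_num)

theorem differentiable_g (hA : Assumptions μ Lf0 Lf1 Lg1 Lg2 f g) :
    Differentiable ℝ (joint g) := hA.contDiff_g.differentiable (by norm_num)

theorem differentiable_g_snd (hA : Assumptions μ Lf0 Lf1 Lg1 Lg2 f g) (x : E dx) :
    Differentiable ℝ (fun y => g x y) :=
  fun y => (hasGradientAt_snd hA.differentiable_g x y).differentiableAt

theorem norm_gradY_f_le (hA : Assumptions μ Lf0 Lf1 Lg1 Lg2 f g) (x : E dx) (y : E dy) :
    ‖gradY f x y‖ ≤ Lf0 := by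
  rw [gradY_eq hA.differentiable_f]
  refine (WithLp.norm_snd_le (p := 2) _ _).trans ?_
  rw [gradient, LinearIsometryEquiv.norm_map]
  exact norm_fderiv_le_of_lipschitz ℝ hA.lip_f

theorem norm_gradX_f_sub_le (hA : Assumptions μ Lf0 Lf1 Lg1 Lg2 f g) (x : E dx) (y y' : E dy) :
    ‖gradX f x y - gradX f x y'‖ ≤ Lf1 * ‖y - y'‖ := by
  rw [gradX_eq hA.differentiable_f, gradX_eq hA.differentiable_f, ← WithLp.sub_fst,
    ← norm_toLp_sub_snd x]
  exact (WithLp.norm_fst_le (p := 2) _ _).trans (hA.lip_grad_f.norm_sub_le _ _)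

theorem norm_gradY_f_sub_le (hA : Assumptions μ Lf0 Lf1 Lg1 Lg2 f g) (x x' : E dx)
    (y y' : E dy) : ‖gradY f x y - gradY f x' y'‖ ≤ Lf1 * (‖x - x'‖ + ‖y - y'‖) := by
  rw [gradY_eq hA.differentiable_f, gradY_eq hA.differentiable_f, ← WithLp.sub_snd]
  refine (WithLp.norm_snd_le (p := 2) _ _).trans ((hA.lip_grad_f.norm_sub_le _ _).trans ?_)
  gcongr
  exact norm_toLp_sub_le _ _ _ _

theorem norm_gradY_g_sub_snd_le (hA : Assumptions μ Lf0 Lf1 Lg1 Lg2 f g) (x : E dx)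
    (y y' : E dy) : ‖gradY g x y - gradY g x y'‖ ≤ Lg1 * ‖y - y'‖ := by
  rw [gradY_eq hA.differentiable_g, gradY_eq hA.differentiable_g, ← WithLp.sub_snd,
    ← norm_toLp_sub_snd x]
  exact (WithLp.norm_snd_le (p := 2) _ _).trans (hA.lip_grad_g.norm_sub_le _ _)

theorem norm_gradY_g_sub_fst_le (hA : Assumptions μ Lf0 Lf1 Lg1 Lg2 f g) (x x' : E dx)
    (y : E dy) : ‖gradY g x y - gradY g x' y‖ ≤ Lg1 * ‖x - x'‖ := by
  rw [gradY_eq hA.differentiable_g, gradY_eq hA.differentiable_g, ← WithLp.sub_snd,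
    ← norm_toLp_sub_fst x x' y]
  exact (WithLp.norm_snd_le (p := 2) _ _).trans (hA.lip_grad_g.norm_sub_le _ _)

theorem norm_hessYY_le (hA : Assumptions μ Lf0 Lf1 Lg1 Lg2 f g) (x : E dx) (y : E dy) :
    ‖hessYY g x y‖ ≤ Lg1 :=
  norm_fderiv_le_of_lipschitz ℝ (LipschitzWith.of_dist_le_mul fun y y' => by
    rw [dist_eq_norm, dist_eq_norm]; exact hA.norm_gradY_g_sub_snd_le x y y')

theorem norm_mixedXY_le (hA : Assumptions μ Lf0 Lf1 Lg1 Lg2 f g) (x : E dx) (y : E dy) :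
    ‖mixedXY g x y‖ ≤ Lg1 := by
  rw [mixedXY, LinearIsometryEquiv.norm_map]
  exact norm_fderiv_le_of_lipschitz ℝ (LipschitzWith.of_dist_le_mul fun x x' => by
    rw [dist_eq_norm, dist_eq_norm]; exact hA.norm_gradY_g_sub_fst_le x x' y)

theorem norm_hessYY_sub_le (hA : Assumptions μ Lf0 Lf1 Lg1 Lg2 f g) (x x' : E dx)
    (y y' : E dy) : ‖hessYY g x y - hessYY g x' y'‖ ≤ Lg2 * (‖x - x'‖ + ‖y - y'‖) := by
  refine (hA.lip_hess_g.norm_sub_le (WithLp.toLp 2 (x, y)) (WithLp.toLp 2 (x', y'))).trans ?_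
  gcongr
  exact norm_toLp_sub_le _ _ _ _

theorem norm_mixedXY_sub_snd_le (hA : Assumptions μ Lf0 Lf1 Lg1 Lg2 f g) (x : E dx)
    (y y' : E dy) : ‖mixedXY g x y - mixedXY g x y'‖ ≤ Lg2 * ‖y - y'‖ := by
  rw [← norm_toLp_sub_snd x y y']
  exact hA.lip_mixed_g.norm_sub_le (WithLp.toLp 2 (x, y)) (WithLp.toLp 2 (x, y'))

theorem gradY_g_monotone (hA : Assumptions μ Lf0 Lf1 Lg1 Lg2 f g) (x : E dx) (y y' : E dy) :
    μ * ‖y - y'‖ ^ 2 ≤ ⟪gradY g x y - gradY g x y', y - y'⟫_ℝ :=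
  strongConvexOn_gradient_monotone (hA.strongConvex x) (hA.differentiable_g_snd x) y y'

/-- Strong monotonicity of the gradient between y + tu and y, divided by t², in the limit t → 0⁺. -/
theorem le_inner_hessYY (hA : Assumptions μ Lf0 Lf1 Lg1 Lg2 f g) (x : E dx) (y u : E dy) :
    μ * ‖u‖ ^ 2 ≤ ⟪hessYY g x y u, u⟫_ℝ := by
  have h2 : HasDerivAt (fun t : ℝ => y + t • u) u 0 := by
    simpa using ((hasDerivAt_id (0 : ℝ)).smul_const u).const_add y
  have h3 : HasFDerivAt (fun y' => gradY g x y') (hessYY g x y) (y + (0 : ℝ) • u) := by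
    simpa using hasFDerivAt_gradY hA.contDiff_g x y
  have h4 := (h3.comp_hasDerivAt 0 h2).inner ℝ (hasDerivAt_const (0 : ℝ) u)
  have h5 := h4.tendsto_slope_zero_right
  simp only [inner_zero_right, zero_add] at h5
  refine ge_of_tendsto h5 ?_
  filter_upwards [self_mem_nhdsWithin] with t ht
  have ht : 0 < t := ht
  have h6 := hA.gradY_g_monotone x (y + t • u) y
  rw [add_sub_cancel_left, norm_smul, Real.norm_eq_abs, abs_of_pos ht, inner_smul_right,
    inner_sub_left] at h6
  simp only [Function.comp_apply, zero_smul, add_zero, smul_eq_mul]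
  rw [le_inv_mul_iff₀ ht]
  refine le_of_mul_le_mul_left ?_ ht
  linarith

theorem mul_norm_le_norm_hessYY (hA : Assumptions μ Lf0 Lf1 Lg1 Lg2 f g) (x : E dx)
    (y u : E dy) : μ * ‖u‖ ≤ ‖hessYY g x y u‖ :=
  mul_norm_le_of_le_inner (hA.le_inner_hessYY x y u)

theorem yStar_le (hA : Assumptions μ Lf0 Lf1 Lg1 Lg2 f g) (hμ : 0 < μ) (x : E dx) (y : E dy) :
    g x (yStar g x) ≤ g x y :=
  Classical.epsilon_spec (p := fun y => ∀ y', g x y ≤ g x y')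
    (exists_minimizer_of_strongConvexOn hμ (hA.strongConvex x) (hA.differentiable_g_snd x)) y

theorem gradY_yStar (hA : Assumptions μ Lf0 Lf1 Lg1 Lg2 f g) (hμ : 0 < μ) (x : E dx) :
    gradY g x (yStar g x) = 0 := by
  have h : IsLocalMin (fun y => g x y) (yStar g x) :=
    Filter.Eventually.of_forall fun y => hA.yStar_le hμ x y
  rw [gradY, gradient, h.fderiv_eq_zero, map_zero]

theorem le_inner_gradY_g (hA : Assumptions μ Lf0 Lf1 Lg1 Lg2 f g) (hμ : 0 < μ) (x : E dx)
    (y : E dy) : μ * ‖y - yStar g x‖ ^ 2 ≤ ⟪gradY g x y, y - yStar g x⟫_ℝ := by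
  have h := hA.gradY_g_monotone x y (yStar g x)
  rwa [hA.gradY_yStar hμ, sub_zero] at h

theorem norm_gradY_g_le (hA : Assumptions μ Lf0 Lf1 Lg1 Lg2 f g) (hμ : 0 < μ) (x : E dx)
    (y : E dy) : ‖gradY g x y‖ ≤ Lg1 * ‖y - yStar g x‖ := by
  have h := hA.norm_gradY_g_sub_snd_le x y (yStar g x)
  rwa [hA.gradY_yStar hμ, sub_zero] at h

theorem mul_norm_sub_yStar_le (hA : Assumptions μ Lf0 Lf1 Lg1 Lg2 f g) (hμ : 0 < μ) (x : E dx)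
    (y : E dy) : μ * ‖y - yStar g x‖ ≤ ‖gradY g x y‖ :=
  mul_norm_le_of_le_inner (hA.le_inner_gradY_g hμ x y)

/-- At y*(x), the gradient of g(x', ·) differs from the zero gradient of g(x, ·) by at most Lg1‖x -
x'‖, and strong monotonicity turns a small gradient into a small distance to y*(x'). -/
theorem norm_yStar_sub_le (hA : Assumptions μ Lf0 Lf1 Lg1 Lg2 f g) (hμ : 0 < μ) (x x' : E dx) :
    ‖yStar g x - yStar g x'‖ ≤ Lg1 / μ * ‖x - x'‖ := by
  have h1 := hA.mul_norm_sub_yStar_le hμ x' (yStar g x)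
  have h2 := hA.norm_gradY_g_sub_fst_le x x' (yStar g x)
  rw [hA.gradY_yStar hμ, zero_sub, norm_neg] at h2
  rw [div_mul_eq_mul_div, le_div_iff₀ hμ]
  linarith

/-- Coercivity makes the Hessian injective, hence surjective in finite dimension, so the choice
defining `vStar` is not void. -/
theorem hessYY_vStar (hA : Assumptions μ Lf0 Lf1 Lg1 Lg2 f g) (hμ : 0 < μ) (x : E dx) :
    hessYY g x (yStar g x) (vStar f g x) = gradY f x (yStar g x) := by
  refine Classical.epsilon_spec
    (p := fun v => hessYY g x (yStar g x) v = gradY f x (yStar g x)) ?_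
  have hinj : Function.Injective (hessYY g x (yStar g x)).toLinearMap := by
    rw [← LinearMap.ker_eq_bot, LinearMap.ker_eq_bot']
    intro u hu
    have h := hA.mul_norm_le_norm_hessYY x (yStar g x) u
    have hu' : hessYY g x (yStar g x) u = 0 := hu
    rw [hu', norm_zero] at h
    exact norm_le_zero_iff.mp (nonpos_of_mul_nonpos_right h hμ)
  exact LinearMap.injective_iff_surjective.mp hinj _

theorem norm_vStar_le (hA : Assumptions μ Lf0 Lf1 Lg1 Lg2 f g) (hμ : 0 < μ) (x : E dx) :
    ‖vStar f g x‖ ≤ Lf0 / μ := by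
  have h := hA.mul_norm_le_norm_hessYY x (yStar g x) (vStar f g x)
  rw [hA.hessYY_vStar hμ] at h
  rw [le_div_iff₀ hμ, mul_comm]
  exact h.trans (hA.norm_gradY_f_le _ _)

/-- The residual of `v*(x)` in the linear system at another point. -/
theorem norm_hessYY_vStar_sub_le (hA : Assumptions μ Lf0 Lf1 Lg1 Lg2 f g) (hμ : 0 < μ)
    (x x' : E dx) (y : E dy) : ‖hessYY g x' y (vStar f g x) - gradY f x' y‖ ≤
      (Lf1 + Lg2 * (Lf0 / μ)) * (‖x' - x‖ + ‖y - yStar g x‖) := by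
  have h1 : hessYY g x' y (vStar f g x) - gradY f x' y =
      (hessYY g x' y - hessYY g x (yStar g x)) (vStar f g x) -
        (gradY f x' y - gradY f x (yStar g x)) := by
    rw [sub_apply, hA.hessYY_vStar hμ]
    abel
  rw [h1, add_mul, add_comm (_ * _)]
  refine (norm_sub_le _ _).trans (add_le_add ?_ (hA.norm_gradY_f_sub_le _ _ _ _))
  refine ((hessYY g x' y - hessYY g x (yStar g x)).le_opNorm_of_le (hA.norm_vStar_le hμ x)).trans ?_
  have := div_nonneg Lf0.coe_nonneg hμ.le
  calc ‖hessYY g x' y - hessYY g x (yStar g x)‖ * (Lf0 / μ)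
      ≤ (Lg2 * (‖x' - x‖ + ‖y - yStar g x‖)) * (Lf0 / μ) := by
        gcongr; exact hA.norm_hessYY_sub_le _ _ _ _
    _ = _ := by ring

/-- The Hessian at (x', y*(x')) maps the difference to the residual of v*(x) there. That residual is
Lipschitz in the base point, and the Hessian is bounded below by μ. -/
theorem norm_vStar_sub_le (hA : Assumptions μ Lf0 Lf1 Lg1 Lg2 f g) (hμ : 0 < μ) (x x' : E dx) :
    ‖vStar f g x - vStar f g x'‖ ≤
      (Lf1 + Lg2 * (Lf0 / μ)) * (1 + Lg1 / μ) / μ * ‖x - x'‖ := by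
  have h1 := hA.mul_norm_le_norm_hessYY x' (yStar g x') (vStar f g x - vStar f g x')
  rw [map_sub, hA.hessYY_vStar hμ x'] at h1
  have h2 := hA.norm_hessYY_vStar_sub_le hμ x x' (yStar g x')
  have h3 := hA.norm_yStar_sub_le hμ x' x
  have h4 : 0 ≤ Lf1 + Lg2 * (Lf0 / μ) := by positivity
  rw [norm_sub_rev x x']
  rw [div_mul_eq_mul_div, le_div_iff₀ hμ]
  have h5 := mul_le_mul_of_nonneg_left h3 h4
  linarith

/-- `Φ` has a first-order expansion with quadratic remainder, whose linear part is given by the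
hypergradient `∇ₓf(x, y*) - ∇ₓ∇_y g(x, y*) v*`. -/
theorem abs_Phi_sub_le (hA : Assumptions μ Lf0 Lf1 Lg1 Lg2 f g) (hμ : 0 < μ) (x x' : E dx) :
    |Phi f g x' - Phi f g x -
      ⟪gradX f x (yStar g x) - mixedXY g x (yStar g x) (vStar f g x), x' - x⟫_ℝ| ≤
      (Lf1 + 2 * Lg2 * (Lf0 / μ)) * (1 + Lg1 / μ) ^ 2 * ‖x' - x‖ ^ 2 := by
  set w := vStar f g x with hw
  have hM := hA.norm_vStar_le hμ x
  have hM0 : 0 ≤ (Lf0 : ℝ) / μ := div_nonneg Lf0.coe_nonneg hμ.le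
  have hC1 := (contDiff_gradY hA.contDiff_g).differentiable (by norm_num)
  -- A Lagrangian with the multiplier frozen at w = v*(x). It equals Φ on the graph of y*, and its
  -- y-derivative at (x, y*(x)) vanishes. Hence only the Lipschitz bound for y* is needed, not its
  -- differentiability.
  let K : WithLp 2 (E dx × E dy) → ℝ := fun z => joint f z - ⟪w, joint (gradY g) z⟫_ℝ
  let K' : WithLp 2 (E dx × E dy) → WithLp 2 (E dx × E dy) →L[ℝ] ℝ := fun z =>
    fderiv ℝ (joint f) z - (innerSL ℝ w).comp (fderiv ℝ (joint (gradY g)) z)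
  have hK : ∀ z, HasFDerivAt K (K' z) z := fun z =>
    (hA.differentiable_f z).hasFDerivAt.sub
      ((innerSL ℝ w).hasFDerivAt.comp z (hC1 z).hasFDerivAt)
  -- The factor 2 adds the x-block and the y-block, each Lg2-Lipschitz.
  have hJ : ∀ z z', ‖fderiv ℝ (joint (gradY g)) z' - fderiv ℝ (joint (gradY g)) z‖ ≤
      2 * Lg2 * ‖z' - z‖ := by
    intro z z'
    refine ContinuousLinearMap.opNorm_le_bound _ (by positivity) fun q => ?_
    have h1 : (fderiv ℝ (joint (gradY g)) z' - fderiv ℝ (joint (gradY g)) z) q =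
        (fderiv ℝ (fun x' => gradY g x' z'.snd) z'.fst -
          fderiv ℝ (fun x' => gradY g x' z.snd) z.fst) q.fst +
        (hessYY g z'.fst z'.snd - hessYY g z.fst z.snd) q.snd := by
      have e1 := fderiv_gradY_apply hA.contDiff_g z'.fst z'.snd q
      have e2 := fderiv_gradY_apply hA.contDiff_g z.fst z.snd q
      change fderiv ℝ (joint (gradY g)) z' q = _ at e1
      change fderiv ℝ (joint (gradY g)) z q = _ at e2
      rw [sub_apply, sub_apply,
        sub_apply, e1, e2]
      abel
    have h2 : ‖fderiv ℝ (fun x' => gradY g x' z'.snd) z'.fst -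
        fderiv ℝ (fun x' => gradY g x' z.snd) z.fst‖ ≤ Lg2 * ‖z' - z‖ := by
      have := hA.lip_mixed_g.norm_sub_le z' z
      rwa [joint, joint, mixedXY, mixedXY, ← map_sub, LinearIsometryEquiv.norm_map] at this
    have h3 : ‖hessYY g z'.fst z'.snd - hessYY g z.fst z.snd‖ ≤ Lg2 * ‖z' - z‖ :=
      hA.lip_hess_g.norm_sub_le z' z
    rw [h1]
    refine (norm_add_le _ _).trans ?_
    have h4 := ContinuousLinearMap.le_of_opNorm_le_of_le _ h2 (WithLp.norm_fst_le (p := 2) _ q)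
    have h5 := ContinuousLinearMap.le_of_opNorm_le_of_le _ h3 (WithLp.norm_snd_le (p := 2) _ q)
    linarith
  have hK' : ∀ z z', ‖K' z' - K' z‖ ≤ (Lf1 + 2 * Lg2 * (Lf0 / μ)) * ‖z' - z‖ := by
    intro z z'
    have h1 : K' z' - K' z = (fderiv ℝ (joint f) z' - fderiv ℝ (joint f) z) -
        (innerSL ℝ w).comp (fderiv ℝ (joint (gradY g)) z' - fderiv ℝ (joint (gradY g)) z) := by
      simp only [K', ContinuousLinearMap.comp_sub]
      abel
    have h2 : ‖fderiv ℝ (joint f) z' - fderiv ℝ (joint f) z‖ ≤ Lf1 * ‖z' - z‖ := by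
      rw [← toDual_gradient, ← toDual_gradient, ← map_sub, LinearIsometryEquiv.norm_map]
      exact hA.lip_grad_f.norm_sub_le z' z
    have h3 : ‖(innerSL ℝ w).comp (fderiv ℝ (joint (gradY g)) z' -
        fderiv ℝ (joint (gradY g)) z)‖ ≤ (Lf0 / μ) * (2 * Lg2 * ‖z' - z‖) := by
      refine (ContinuousLinearMap.opNorm_comp_le _ _).trans ?_
      rw [innerSL_apply_norm]
      gcongr
      exact hJ z z'
    rw [h1]
    refine (norm_sub_le _ _).trans ?_
    linarith
  have hmain := norm_sub_sub_le_of_lipschitz_fderiv (by positivity) hK hK'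
    (WithLp.toLp 2 (x, yStar g x)) (WithLp.toLp 2 (x', yStar g x'))
  have hKx : ∀ x, K (WithLp.toLp 2 (x, yStar g x)) = Phi f g x := by
    intro x
    change f x (yStar g x) - ⟪w, gradY g x (yStar g x)⟫_ℝ = _
    rw [hA.gradY_yStar hμ, inner_zero_right, sub_zero]
    rfl
  -- The two y-contributions cancel, by symmetry of the Hessian and the linear system solved by
  -- v*(x).
  have hlin : K' (WithLp.toLp 2 (x, yStar g x))
      (WithLp.toLp 2 (x', yStar g x') - WithLp.toLp 2 (x, yStar g x)) =
      ⟪gradX f x (yStar g x) - mixedXY g x (yStar g x) w, x' - x⟫_ℝ := by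
    rw [← WithLp.toLp_sub, Prod.mk_sub_mk]
    have e1 : fderiv ℝ (joint f) (WithLp.toLp 2 (x, yStar g x))
        (WithLp.toLp 2 (x' - x, yStar g x' - yStar g x)) =
        ⟪gradX f x (yStar g x), x' - x⟫_ℝ +
          ⟪gradY f x (yStar g x), yStar g x' - yStar g x⟫_ℝ := by
      rw [← inner_gradient_left, WithLp.prod_inner_apply, gradX_eq hA.differentiable_f,
        gradY_eq hA.differentiable_f]
      rfl
    change fderiv ℝ (joint f) (WithLp.toLp 2 (x, yStar g x)) _ -
      ⟪w, fderiv ℝ (joint (gradY g)) (WithLp.toLp 2 (x, yStar g x)) _⟫_ℝ = _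
    rw [e1, fderiv_gradY_apply hA.contDiff_g, inner_add_right, inner_sub_left, mixedXY,
      ContinuousLinearMap.adjoint_inner_left, real_inner_comm _ w,
      real_inner_comm (hessYY g x (yStar g x) _) w, inner_hessYY_comm hA.contDiff_g,
      hw, hA.hessYY_vStar hμ, real_inner_comm _ (vStar f g x)]
    simp only [WithLp.toLp_fst, WithLp.toLp_snd]
    ring
  rw [hKx, hKx, hlin] at hmain
  refine hmain.trans ?_
  have h1 : ‖(WithLp.toLp 2 (x', yStar g x') - WithLp.toLp 2 (x, yStar g x) :
      WithLp 2 (E dx × E dy))‖ ≤ (1 + Lg1 / μ) * ‖x' - x‖ := by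
    refine (norm_toLp_sub_le _ _ _ _).trans ?_
    have := hA.norm_yStar_sub_le hμ x' x
    linarith
  calc _ ≤ (Lf1 + 2 * Lg2 * (Lf0 / μ)) * ((1 + Lg1 / μ) * ‖x' - x‖) ^ 2 := by gcongr
    _ = _ := by ring

theorem hasGradientAt_Phi (hA : Assumptions μ Lf0 Lf1 Lg1 Lg2 f g) (hμ : 0 < μ) (x : E dx) :
    HasGradientAt (Phi f g)
      (gradX f x (yStar g x) - mixedXY g x (yStar g x) (vStar f g x)) x := by
  rw [hasGradientAt_iff_hasFDerivAt]
  set D := gradX f x (yStar g x) - mixedXY g x (yStar g x) (vStar f g x)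
  have h1 : (fun x' => Phi f g x' - Phi f g x - ⟪D, x' - x⟫_ℝ) =O[nhds x]
      fun x' => ‖x' - x‖ ^ 2 :=
    Asymptotics.isBigO_iff.mpr ⟨_, Filter.Eventually.of_forall fun x' => by
      rw [Real.norm_eq_abs, Real.norm_eq_abs, abs_of_nonneg (sq_nonneg ‖x' - x‖)]
      exact hA.abs_Phi_sub_le hμ x x'⟩
  have h2 := h1.hasFDerivAt (𝕜 := ℝ) (n := 2) one_lt_two
  have h3 := h2.add (((InnerProductSpace.toDual ℝ (E dx) D).hasFDerivAt (x := x)).add_const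
    (Phi f g x - ⟪D, x⟫_ℝ))
  rw [zero_add] at h3
  refine h3.congr_of_eventuallyEq (Filter.Eventually.of_forall fun x' => ?_)
  simp only [Pi.add_apply, InnerProductSpace.toDual_apply_apply, inner_sub_right]
  ring

/-- The splitting lets the variation of ∇ₓ∇_y g act on v*, which is bounded, and only its norm bound
act on v - v*. No a priori bound on v is needed. -/
theorem norm_gradient_Phi_sub_le (hA : Assumptions μ Lf0 Lf1 Lg1 Lg2 f g) (hμ : 0 < μ)
    (x : E dx) (y v : E dy) :
    ‖gradient (Phi f g) x - (gradX f x y - mixedXY g x y v)‖ ≤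
      (Lf1 + Lg2 * (Lf0 / μ)) * ‖y - yStar g x‖ + Lg1 * ‖v - vStar f g x‖ := by
  rw [(hA.hasGradientAt_Phi hμ x).gradient]
  have h : gradX f x (yStar g x) - mixedXY g x (yStar g x) (vStar f g x) -
      (gradX f x y - mixedXY g x y v) = -(gradX f x y - gradX f x (yStar g x)) +
      (mixedXY g x y - mixedXY g x (yStar g x)) (vStar f g x) +
      mixedXY g x y (v - vStar f g x) := by
    rw [sub_apply, map_sub]
    abel
  rw [h]
  have h1 := hA.norm_gradX_f_sub_le x y (yStar g x)
  rw [← norm_neg] at h1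
  have h2 := ContinuousLinearMap.le_of_opNorm_le_of_le _
    (hA.norm_mixedXY_sub_snd_le x y (yStar g x)) (hA.norm_vStar_le hμ x)
  have h3 := (mixedXY g x y).le_of_opNorm_le (hA.norm_mixedXY_le x y) (v - vStar f g x)
  refine (norm_add₃_le).trans ?_
  linarith

end Assumptions

/-! ### One-step inequalities -/

/-- One gradient step towards a moving target, for a field satisfying a strong monotonicity
inequality up to an error `e`. -/
theorem tracking_step_le {V : Type*} [NormedAddCommGroup V] [InnerProductSpace ℝ V]
    {m c e τ τ₀ : ℝ} (hm : 0 < m) (hc : 0 ≤ c) (he : 0 ≤ e) (hτ : 0 < τ) (hτ₀ : τ ≤ τ₀)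
    (y z z' p : V) (h : m * ‖y - z‖ ^ 2 + c * ‖p‖ ^ 2 - e ≤ ⟪p, y - z⟫_ℝ) :
    2 * c * (τ * ‖p‖ ^ 2) ≤ ‖y - z‖ ^ 2 - ‖y - τ • p - z'‖ ^ 2 +
      (1 + 2 * m * τ₀) * (2 * (τ * e) + τ ^ 2 * ‖p‖ ^ 2) +
      τ⁻¹ * (τ₀ + 1 / (2 * m)) * ‖z - z'‖ ^ 2 := by
  set u := y - τ • p - z with hu
  set w := z - z' with hw
  -- As a Young parameter, η exactly offsets the contraction: (1 + η)(1 - η) ≤ 1 for every step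
  -- size, even when 1 - η is negative.
  set η := 2 * m * τ with hη
  have hη0 : 0 < η := by positivity
  have h1 : ‖y - τ • p - z'‖ ^ 2 ≤ (1 + η) * ‖u‖ ^ 2 + (1 + 1 / η) * ‖w‖ ^ 2 := by
    have e1 : y - τ • p - z' = u + w := by rw [hu, hw]; abel
    have e2 : 2 * ⟪u, w⟫_ℝ ≤ η * ‖u‖ ^ 2 + 1 / η * ‖w‖ ^ 2 := by
      have e3 := sq_nonneg ‖η • u - w‖
      rw [norm_sub_sq_real, norm_smul, Real.norm_eq_abs, abs_of_pos hη0, inner_smul_left] at e3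
      simp only [conj_trivial] at e3
      rw [← sub_nonneg]
      have e4 : η * ‖u‖ ^ 2 + 1 / η * ‖w‖ ^ 2 - 2 * ⟪u, w⟫_ℝ =
          1 / η * ((η * ‖u‖) ^ 2 - 2 * (η * ⟪u, w⟫_ℝ) + ‖w‖ ^ 2) := by field_simp; ring
      rw [e4]
      positivity
    rw [e1, norm_add_sq_real]
    linarith
  have h2 : ‖u‖ ^ 2 ≤ (1 - η) * ‖y - z‖ ^ 2 - 2 * c * (τ * ‖p‖ ^ 2) +
      (2 * (τ * e) + τ ^ 2 * ‖p‖ ^ 2) := by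
    have e1 : u = (y - z) - τ • p := by rw [hu]; abel
    rw [e1, norm_sub_sq_real, norm_smul, Real.norm_eq_abs, abs_of_pos hτ, inner_smul_right,
      real_inner_comm, mul_pow, hη]
    have := mul_le_mul_of_nonneg_left h hτ.le
    linarith
  have h3 := mul_le_mul_of_nonneg_left h2 (show 0 ≤ 1 + η by positivity)
  have h4 : (1 + η) * (2 * (τ * e) + τ ^ 2 * ‖p‖ ^ 2) ≤
      (1 + 2 * m * τ₀) * (2 * (τ * e) + τ ^ 2 * ‖p‖ ^ 2) := by
    rw [hη]; gcongr
  have h5 : (1 + 1 / η) * ‖w‖ ^ 2 ≤ τ⁻¹ * (τ₀ + 1 / (2 * m)) * ‖w‖ ^ 2 := by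
    have : 1 + 1 / η = τ⁻¹ * (τ + 1 / (2 * m)) := by rw [hη]; field_simp
    rw [this]; gcongr
  have h6 : 0 ≤ η * (2 * c * (τ * ‖p‖ ^ 2)) := by positivity
  have h7 : 0 ≤ η ^ 2 * ‖y - z‖ ^ 2 := by positivity
  linarith only [h1, h3, h4, h5, h6, h7]

namespace Assumptions

variable {dx dy : ℕ} {μ : ℝ} {Lf0 Lf1 Lg1 Lg2 : ℝ≥0} {f g : E dx → E dy → ℝ}

theorem norm_sub_yStar_sq_le (hA : Assumptions μ Lf0 Lf1 Lg1 Lg2 f g) (hμ : 0 < μ) (x : E dx)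
    (y : E dy) : ‖y - yStar g x‖ ^ 2 ≤ ‖gradY g x y‖ ^ 2 / μ ^ 2 := by
  rw [le_div_iff₀ (by positivity), ← mul_pow, mul_comm]
  have := hA.mul_norm_sub_yStar_le hμ x y
  gcongr

/-- The part of `∇_v R` that does not vanish at `v*(x)`. -/
theorem norm_residual_sq_le (hA : Assumptions μ Lf0 Lf1 Lg1 Lg2 f g) (hμ : 0 < μ) (x : E dx)
    (y : E dy) : ‖hessYY g x y (vStar f g x) - gradY f x y‖ ^ 2 ≤
      (Lf1 + Lg2 * (Lf0 / μ)) ^ 2 / μ ^ 2 * ‖gradY g x y‖ ^ 2 := by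
  have h := hA.norm_hessYY_vStar_sub_le hμ x x y
  rw [sub_self, norm_zero, zero_add] at h
  calc _ ≤ ((Lf1 + Lg2 * (Lf0 / μ)) * ‖y - yStar g x‖) ^ 2 := by gcongr
    _ = (Lf1 + Lg2 * (Lf0 / μ)) ^ 2 * ‖y - yStar g x‖ ^ 2 := mul_pow _ _ _
    _ ≤ (Lf1 + Lg2 * (Lf0 / μ)) ^ 2 * (‖gradY g x y‖ ^ 2 / μ ^ 2) := by
      gcongr; exact hA.norm_sub_yStar_sq_le hμ x y
    _ = _ := by ring

theorem gradVR_eq_add (hA : Assumptions μ Lf0 Lf1 Lg1 Lg2 f g) (x : E dx) (y v : E dy) :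
    gradVR f g x y v = hessYY g x y (v - vStar f g x) +
      (hessYY g x y (vStar f g x) - gradY f x y) := by
  rw [gradVR_eq hA.contDiff_g, map_sub]
  abel

theorem norm_sub_vStar_sq_le (hA : Assumptions μ Lf0 Lf1 Lg1 Lg2 f g) (hμ : 0 < μ) (x : E dx)
    (y v : E dy) : ‖v - vStar f g x‖ ^ 2 ≤ 2 / μ ^ 2 * ‖gradVR f g x y v‖ ^ 2 +
      2 / μ ^ 2 * ((Lf1 + Lg2 * (Lf0 / μ)) ^ 2 / μ ^ 2) * ‖gradY g x y‖ ^ 2 := by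
  have h1 := hA.mul_norm_le_norm_hessYY x y (v - vStar f g x)
  have h2 : hessYY g x y (v - vStar f g x) = gradVR f g x y v -
      (hessYY g x y (vStar f g x) - gradY f x y) := by
    rw [hA.gradVR_eq_add]; abel
  rw [h2] at h1
  have h3 := h1.trans (norm_sub_le _ _)
  have h4 := hA.norm_residual_sq_le hμ x y
  set b := ‖hessYY g x y (vStar f g x) - gradY f x y‖
  set r := ‖gradVR f g x y v‖
  have h5 : (μ * ‖v - vStar f g x‖) ^ 2 ≤ (r + b) ^ 2 := by gcongr
  have h6 : (r + b) ^ 2 ≤ 2 * (r ^ 2 + b ^ 2) := add_sq_le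
  have h7 : ‖v - vStar f g x‖ ^ 2 ≤ 2 / μ ^ 2 * (r ^ 2 + b ^ 2) := by
    rw [div_mul_eq_mul_div, le_div_iff₀ (by positivity)]
    linarith
  have h8 := mul_le_mul_of_nonneg_left h4 (show 0 ≤ 2 / μ ^ 2 by positivity)
  linarith

/-- Half of the strong monotonicity is kept as distance, and part of the rest is traded for ‖∇_y g‖²
by smoothness. Lg1 + 1 avoids a zero denominator, and `- 0` is the error slot of `tracking_step_le`.
-/
theorem gradY_g_strong_inner (hA : Assumptions μ Lf0 Lf1 Lg1 Lg2 f g) (hμ : 0 < μ) (x : E dx)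
    (y : E dy) : μ / 2 * ‖y - yStar g x‖ ^ 2 +
      μ / (8 * (Lg1 + 1) ^ 2) * ‖gradY g x y‖ ^ 2 - 0 ≤ ⟪gradY g x y, y - yStar g x⟫_ℝ := by
  have h1 := hA.le_inner_gradY_g hμ x y
  have h2 : ‖gradY g x y‖ ^ 2 ≤ ((Lg1 + 1) * ‖y - yStar g x‖) ^ 2 := by
    gcongr
    refine (hA.norm_gradY_g_le hμ x y).trans ?_
    gcongr
    linarith
  have h3 : μ / (8 * (Lg1 + 1) ^ 2) * ‖gradY g x y‖ ^ 2 ≤ μ / 8 * ‖y - yStar g x‖ ^ 2 := by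
    calc _ ≤ μ / (8 * (Lg1 + 1) ^ 2) * ((Lg1 + 1) * ‖y - yStar g x‖) ^ 2 := by gcongr
      _ = _ := by field_simp
  have : 0 ≤ μ * ‖y - yStar g x‖ ^ 2 := by positivity
  linarith

/-- Of the coercivity μ‖v - v*‖², a quarter absorbs the cross term with the residual at v*, a
quarter pays for ‖∇_v R‖², and half remains. The residual appears because y ≠ y*(x), and it is
charged to ‖∇_y g‖². -/
theorem gradVR_strong_inner (hA : Assumptions μ Lf0 Lf1 Lg1 Lg2 f g) (hμ : 0 < μ) (x : E dx)
    (y v : E dy) : μ / 2 * ‖v - vStar f g x‖ ^ 2 +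
      μ / (8 * (Lg1 + 1) ^ 2) * ‖gradVR f g x y v‖ ^ 2 -
      (1 / μ + μ) * ((Lf1 + Lg2 * (Lf0 / μ)) ^ 2 / μ ^ 2 * ‖gradY g x y‖ ^ 2) ≤
      ⟪gradVR f g x y v, v - vStar f g x⟫_ℝ := by
  have h0 := mul_le_mul_of_nonneg_left (hA.norm_residual_sq_le hμ x y)
    (show 0 ≤ 1 / μ + μ by positivity)
  refine le_trans (sub_le_sub_left h0 _) ?_
  have hr := hA.gradVR_eq_add x y v
  have h1 := hA.le_inner_hessYY x y (v - vStar f g x)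
  have h2 := (hessYY g x y).le_of_opNorm_le (hA.norm_hessYY_le x y) (v - vStar f g x)
  set e := v - vStar f g x
  set b := hessYY g x y (vStar f g x) - gradY f x y
  have h3 := neg_le_of_abs_le (abs_real_inner_le_norm b e)
  have h4 : ‖b‖ * ‖e‖ ≤ μ / 4 * ‖e‖ ^ 2 + 1 / μ * ‖b‖ ^ 2 := by
    have : μ / 4 * ‖e‖ ^ 2 + 1 / μ * ‖b‖ ^ 2 - ‖b‖ * ‖e‖ =
        1 / μ * (μ / 2 * ‖e‖ - ‖b‖) ^ 2 := by field_simp; ring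
    have : 0 ≤ 1 / μ * (μ / 2 * ‖e‖ - ‖b‖) ^ 2 := by positivity
    linarith
  have h5 : ‖gradVR f g x y v‖ ^ 2 ≤ 2 * (Lg1 + 1) ^ 2 * (‖e‖ ^ 2 + ‖b‖ ^ 2) := by
    have h6 : ‖gradVR f g x y v‖ ≤ (Lg1 + 1) * ‖e‖ + (Lg1 + 1) * ‖b‖ := by
      rw [hr]
      refine (norm_add_le _ _).trans ?_
      nlinarith [norm_nonneg e, norm_nonneg b, Lg1.coe_nonneg]
    calc _ ≤ ((Lg1 + 1) * ‖e‖ + (Lg1 + 1) * ‖b‖) ^ 2 := by gcongr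
      _ ≤ 2 * (((Lg1 + 1) * ‖e‖) ^ 2 + ((Lg1 + 1) * ‖b‖) ^ 2) := add_sq_le
      _ = _ := by ring
  have h7 : μ / (8 * (Lg1 + 1) ^ 2) * ‖gradVR f g x y v‖ ^ 2 ≤
      μ / 4 * (‖e‖ ^ 2 + ‖b‖ ^ 2) := by
    calc _ ≤ μ / (8 * (Lg1 + 1) ^ 2) * (2 * (Lg1 + 1) ^ 2 * (‖e‖ ^ 2 + ‖b‖ ^ 2)) := by gcongr
      _ = _ := by field_simp; ring
  have h8 : ⟪gradVR f g x y v, e⟫_ℝ = ⟪hessYY g x y e, e⟫_ℝ + ⟪b, e⟫_ℝ := by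
    rw [hr, inner_add_left]
  have h9 : 0 ≤ μ * ‖b‖ ^ 2 := by positivity
  rw [h8]
  linarith

theorem norm_gradient_Phi_sub_sq_le (hA : Assumptions μ Lf0 Lf1 Lg1 Lg2 f g) (hμ : 0 < μ)
    (x : E dx) (y v : E dy) :
    ‖gradient (Phi f g) x - (gradX f x y - mixedXY g x y v)‖ ^ 2 ≤
      (2 * (Lf1 + Lg2 * (Lf0 / μ)) ^ 2 / μ ^ 2 + 4 * Lg1 ^ 2 / μ ^ 2 *
        (1 + (Lf1 + Lg2 * (Lf0 / μ)) ^ 2 / μ ^ 2)) *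
        (‖gradY g x y‖ ^ 2 + ‖gradVR f g x y v‖ ^ 2) := by
  set B := (Lf1 : ℝ) + Lg2 * (Lf0 / μ) with hB
  have h1 := hA.norm_gradient_Phi_sub_le hμ x y v
  have h2 := hA.norm_sub_yStar_sq_le hμ x y
  have h3 := hA.norm_sub_vStar_sq_le hμ x y v
  set p := ‖gradY g x y‖ ^ 2
  set r := ‖gradVR f g x y v‖ ^ 2
  have hp : 0 ≤ p := sq_nonneg _
  have hr : 0 ≤ r := sq_nonneg _
  calc _ ≤ (B * ‖y - yStar g x‖ + Lg1 * ‖v - vStar f g x‖) ^ 2 := by gcongr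
    _ ≤ 2 * ((B * ‖y - yStar g x‖) ^ 2 + (Lg1 * ‖v - vStar f g x‖) ^ 2) := add_sq_le
    _ = 2 * (B ^ 2 * ‖y - yStar g x‖ ^ 2 + Lg1 ^ 2 * ‖v - vStar f g x‖ ^ 2) := by ring
    _ ≤ 2 * (B ^ 2 * (p / μ ^ 2) + Lg1 ^ 2 *
        (2 / μ ^ 2 * r + 2 / μ ^ 2 * (B ^ 2 / μ ^ 2) * p)) := by gcongr
    _ ≤ _ := by
      have e1 : 0 ≤ B ^ 2 / μ ^ 2 * r := by positivity
      have e2 : 0 ≤ Lg1 ^ 2 / μ ^ 2 * p := by positivity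
      have e3 : 0 ≤ Lg1 ^ 2 / μ ^ 2 * (B ^ 2 / μ ^ 2) * r := by positivity
      rw [← sub_nonneg]
      have e4 : (2 * B ^ 2 / μ ^ 2 + 4 * Lg1 ^ 2 / μ ^ 2 * (1 + B ^ 2 / μ ^ 2)) * (p + r) -
          2 * (B ^ 2 * (p / μ ^ 2) + Lg1 ^ 2 *
            (2 / μ ^ 2 * r + 2 / μ ^ 2 * (B ^ 2 / μ ^ 2) * p)) =
          2 * (B ^ 2 / μ ^ 2 * r) + 4 * (Lg1 ^ 2 / μ ^ 2 * p) +
            4 * (Lg1 ^ 2 / μ ^ 2 * (B ^ 2 / μ ^ 2) * r) := by ring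
      rw [e4]
      positivity

/-- The target moves by at most (Lg1/μ)‖d‖/(αφ). The factor τ⁻¹ = β ≤ φ cancels one power of φ,
which leaves the drift ‖d‖²/(α²φ). -/
theorem yStar_tracking (hA : Assumptions μ Lf0 Lf1 Lg1 Lg2 f g) (hμ : 0 < μ) {β₀ α β φ : ℝ}
    (hβ₀ : 0 < β₀) (hα : 0 < α) (hβ : β₀ ≤ β) (hφ : β ≤ φ) (x d : E dx) (y : E dy) :
    2 * (μ / (8 * (Lg1 + 1) ^ 2)) * (‖gradY g x y‖ ^ 2 / β) ≤
      ‖y - yStar g x‖ ^ 2 -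
        ‖y - (1 / β) • gradY g x y - yStar g (x - (1 / (α * φ)) • d)‖ ^ 2 +
      (1 + μ / β₀) * (‖gradY g x y‖ ^ 2 / β ^ 2) +
      (1 / β₀ + 1 / μ) * (Lg1 / μ) ^ 2 * (‖d‖ ^ 2 / (α ^ 2 * φ)) := by
  have hβ' : 0 < β := hβ₀.trans_le hβ
  have hφ' : 0 < φ := hβ'.trans_le hφ
  have h := tracking_step_le (τ := 1 / β) (τ₀ := 1 / β₀) (half_pos hμ) (by positivity) le_rfl
    (by positivity) (by gcongr) y (yStar g x) (yStar g (x - (1 / (α * φ)) • d))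
    (gradY g x y) (hA.gradY_g_strong_inner hμ x y)
  have h0 : 1 / β * ‖gradY g x y‖ ^ 2 = ‖gradY g x y‖ ^ 2 / β := by ring
  rw [h0] at h
  refine h.trans ?_
  have h1 := hA.norm_yStar_sub_le hμ x (x - (1 / (α * φ)) • d)
  rw [sub_sub_cancel, norm_smul, Real.norm_of_nonneg (by positivity)] at h1
  have h2 : (1 / β)⁻¹ * (1 / β₀ + 1 / (2 * (μ / 2))) *
      ‖yStar g x - yStar g (x - (1 / (α * φ)) • d)‖ ^ 2 ≤
      (1 / β₀ + 1 / μ) * (Lg1 / μ) ^ 2 * (‖d‖ ^ 2 / (α ^ 2 * φ)) := by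
    calc _ ≤ φ * (1 / β₀ + 1 / (2 * (μ / 2))) *
          (Lg1 / μ * (1 / (α * φ) * ‖d‖)) ^ 2 := by
          gcongr
          simpa using hφ
      _ = _ := by field_simp
  have h3 : (1 + 2 * (μ / 2) * (1 / β₀)) *
      (2 * (1 / β * 0) + (1 / β) ^ 2 * ‖gradY g x y‖ ^ 2) =
      (1 + μ / β₀) * (‖gradY g x y‖ ^ 2 / β ^ 2) := by field_simp; ring
  rw [h3]
  linarith

theorem vStar_tracking (hA : Assumptions μ Lf0 Lf1 Lg1 Lg2 f g) (hμ : 0 < μ) {β₀ α φ : ℝ}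
    (hβ₀ : 0 < β₀) (hα : 0 < α) (hφ : β₀ ≤ φ) (x d : E dx) (y v : E dy) :
    2 * (μ / (8 * (Lg1 + 1) ^ 2)) * (‖gradVR f g x y v‖ ^ 2 / φ) ≤
      ‖v - vStar f g x‖ ^ 2 -
        ‖v - (1 / φ) • gradVR f g x y v - vStar f g (x - (1 / (α * φ)) • d)‖ ^ 2 +
      (1 + μ / β₀) * (‖gradVR f g x y v‖ ^ 2 / φ ^ 2) +
      2 * (1 + μ / β₀) * (1 / μ + μ) * ((Lf1 + Lg2 * (Lf0 / μ)) ^ 2 / μ ^ 2) *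
        (‖gradY g x y‖ ^ 2 / φ) +
      (1 / β₀ + 1 / μ) * ((Lf1 + Lg2 * (Lf0 / μ)) * (1 + Lg1 / μ) / μ) ^ 2 *
        (‖d‖ ^ 2 / (α ^ 2 * φ)) := by
  have hφ' : 0 < φ := hβ₀.trans_le hφ
  have h := tracking_step_le (τ := 1 / φ) (τ₀ := 1 / β₀) (half_pos hμ) (by positivity)
    (by positivity) (by positivity) (by gcongr) v (vStar f g x)
    (vStar f g (x - (1 / (α * φ)) • d)) (gradVR f g x y v) (hA.gradVR_strong_inner hμ x y v)
  have h0 : 1 / φ * ‖gradVR f g x y v‖ ^ 2 = ‖gradVR f g x y v‖ ^ 2 / φ := by ring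
  rw [h0] at h
  refine h.trans ?_
  have h1 := hA.norm_vStar_sub_le hμ x (x - (1 / (α * φ)) • d)
  rw [sub_sub_cancel, norm_smul, Real.norm_of_nonneg (by positivity)] at h1
  set Lv := (Lf1 + Lg2 * (Lf0 / μ)) * (1 + Lg1 / μ) / μ
  have h2 : (1 / φ)⁻¹ * (1 / β₀ + 1 / (2 * (μ / 2))) *
      ‖vStar f g x - vStar f g (x - (1 / (α * φ)) • d)‖ ^ 2 ≤
      (1 / β₀ + 1 / μ) * Lv ^ 2 * (‖d‖ ^ 2 / (α ^ 2 * φ)) := by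
    calc _ ≤ (1 / φ)⁻¹ * (1 / β₀ + 1 / (2 * (μ / 2))) * (Lv * (1 / (α * φ) * ‖d‖)) ^ 2 := by
          gcongr
      _ = _ := by field_simp
  set D := (Lf1 + Lg2 * (Lf0 / μ)) ^ 2 / μ ^ 2
  have h3 : (1 + 2 * (μ / 2) * (1 / β₀)) *
      (2 * (1 / φ * ((1 / μ + μ) * (D * ‖gradY g x y‖ ^ 2))) +
        (1 / φ) ^ 2 * ‖gradVR f g x y v‖ ^ 2) =
      (1 + μ / β₀) * (‖gradVR f g x y v‖ ^ 2 / φ ^ 2) +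
      2 * (1 + μ / β₀) * (1 / μ + μ) * D * (‖gradY g x y‖ ^ 2 / φ) := by ring
  rw [h3]
  linarith

/-- Polarization, 2⟨∇Φ, d⟩ = ‖∇Φ‖² + ‖d‖² - ‖∇Φ - d‖², keeps ‖d‖² on the left. The smoothness term
in τ² is retained rather than absorbed, so τ is unrestricted. -/
theorem Phi_descent (hA : Assumptions μ Lf0 Lf1 Lg1 Lg2 f g) (hμ : 0 < μ) {τ : ℝ} (hτ : 0 ≤ τ)
    (x : E dx) (y v : E dy) :
    (‖gradient (Phi f g) x‖ ^ 2 + ‖gradX f x y - mixedXY g x y v‖ ^ 2) * τ ≤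
      2 * (Phi f g x - Phi f g (x - τ • (gradX f x y - mixedXY g x y v))) +
      (2 * (Lf1 + Lg2 * (Lf0 / μ)) ^ 2 / μ ^ 2 + 4 * Lg1 ^ 2 / μ ^ 2 *
        (1 + (Lf1 + Lg2 * (Lf0 / μ)) ^ 2 / μ ^ 2)) *
        ((‖gradY g x y‖ ^ 2 + ‖gradVR f g x y v‖ ^ 2) * τ) +
      2 * ((Lf1 + 2 * Lg2 * (Lf0 / μ)) * (1 + Lg1 / μ) ^ 2) *
        (‖gradX f x y - mixedXY g x y v‖ ^ 2 * τ ^ 2) := by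
  set d := gradX f x y - mixedXY g x y v with hd
  have h1 := (abs_le.mp (hA.abs_Phi_sub_le hμ x (x - τ • d))).2
  have h2 := hA.norm_gradient_Phi_sub_sq_le hμ x y v
  rw [← (hA.hasGradientAt_Phi hμ x).gradient, sub_sub_cancel_left, inner_neg_right,
    inner_smul_right, norm_neg, norm_smul, Real.norm_of_nonneg hτ] at h1
  rw [← hd, norm_sub_sq_real] at h2
  have h3 := mul_le_mul_of_nonneg_right h2 hτ
  linarith only [h1, h3]

end Assumptions

/-! ### Summation along the algorithm -/

theorem gradCount_eq {dx dy : ℕ} (f g : E dx → E dy → ℝ) (s₀ : State dx dy) (T : ℕ) :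
    gradCount f g s₀ T = 5 * T := by
  induction T with
  | zero => rfl
  | succ T ih =>
    have h : gradCount f g s₀ (T + 1) = gradCount f g s₀ T + 5 := Prog.cost_bind f g _ _
    omega

theorem iterate_pos {dx dy : ℕ} {f g : E dx → E dy → ℝ} (hg : ContDiff ℝ 2 (joint g))
    {s₀ : State dx dy} (hα : 0 < s₀.α) (hβ : 0 < s₀.β) (hγ : 0 < s₀.γ) (t : ℕ) :
    0 < (iterate f g s₀ t).α ∧ 0 < (iterate f g s₀ t).β ∧ 0 < (iterate f g s₀ t).γ := by
  induction t with
  | zero => exact ⟨hα, hβ, hγ⟩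
  | succ t ih =>
    obtain ⟨h1, h2, h3⟩ := ih
    rw [iterate_succ hg]
    refine ⟨Real.sqrt_pos.mpr ?_, Real.sqrt_pos.mpr ?_, Real.sqrt_pos.mpr ?_⟩ <;> positivity

/-- The squared hypergradient norms along S-TFBO are summable, with a bound that depends only on
the constants of the problem. -/
theorem exists_sum_sq_norm_gradient_Phi_le (μ : ℝ) (Lf0 Lf1 Lg1 Lg2 : ℝ≥0)
    (α₀ β₀ γ₀ Δ G : ℝ) (hμ : 0 < μ) (hα : 1 ≤ α₀) (hβ : 0 < β₀) (hγ : 0 < γ₀) :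
    ∃ K : ℝ, 0 < K ∧ ∀ (dx dy : ℕ) (f g : E dx → E dy → ℝ) (x₀ : E dx) (y₀ v₀ : E dy),
      Assumptions μ Lf0 Lf1 Lg1 Lg2 f g → Phi f g x₀ - (⨅ x, Phi f g x) ≤ Δ →
      ‖gradY g x₀ y₀‖ ≤ G → ‖gradVR f g x₀ y₀ v₀‖ ≤ G →
      ∀ T, ∑ t ∈ Finset.range T,
        ‖gradient (Phi f g) (iterate f g ⟨x₀, y₀, v₀, α₀, β₀, γ₀⟩ t).x‖ ^ 2 ≤ K := by
  set B : ℝ := Lf1 + Lg2 * (Lf0 / μ) with hB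
  set C₁ := 1 + μ / β₀ with hC₁
  set C₂ := (1 / β₀ + 1 / μ) * (Lg1 / μ) ^ 2 with hC₂
  set C₃ := 2 * (1 + μ / β₀) * (1 / μ + μ) * (B ^ 2 / μ ^ 2) with hC₃
  set C₄ := (1 / β₀ + 1 / μ) * (B * (1 + Lg1 / μ) / μ) ^ 2 with hC₄
  set C₅ := 2 * B ^ 2 / μ ^ 2 + 4 * Lg1 ^ 2 / μ ^ 2 * (1 + B ^ 2 / μ ^ 2) with hC₅
  set C₆ := 2 * ((Lf1 + 2 * Lg2 * (Lf0 / μ)) * (1 + Lg1 / μ) ^ 2) with hC₆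
  set C₇ := G ^ 2 / μ ^ 2 with hC₇
  set C₈ := 2 / μ ^ 2 * G ^ 2 + 2 / μ ^ 2 * (B ^ 2 / μ ^ 2) * G ^ 2 with hC₈
  have p₁ : 0 ≤ C₁ := by positivity
  have p₂ : 0 ≤ C₂ := by positivity
  have p₃ : 0 ≤ C₃ := by positivity
  have p₄ : 0 ≤ C₄ := by positivity
  have p₅ : 0 ≤ C₅ := by positivity
  have p₆ : 0 ≤ C₆ := by positivity
  have p₇ : 0 ≤ C₇ := by positivity
  have p₈ : 0 ≤ C₈ := by positivity
  have p₉ : 0 ≤ |Δ| := abs_nonneg Δ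
  -- One constant above every coefficient of the one-step inequalities, the two initial squared
  -- distances (through `G`) and the initial gap of Φ.
  obtain ⟨C, hC, q₁, q₂, q₃, q₄, q₅, q₆, q₇, q₈, q₉⟩ : ∃ C : ℝ, 0 < C ∧ C₁ ≤ C ∧ C₂ ≤ C ∧
      C₃ ≤ C ∧ C₄ ≤ C ∧ C₅ ≤ C ∧ C₆ ≤ C ∧ C₇ ≤ C ∧ C₈ ≤ C ∧ |Δ| ≤ C := by
    refine ⟨C₁ + C₂ + C₃ + C₄ + C₅ + C₆ + C₇ + C₈ + |Δ| + 1, ?_, ?_, ?_, ?_, ?_, ?_, ?_, ?_,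
      ?_, ?_⟩ <;> linarith only [p₁, p₂, p₃, p₄, p₅, p₆, p₇, p₈, p₉]
  obtain ⟨K, hK, H⟩ := exists_sum_le α₀ β₀ γ₀ (2 * (μ / (8 * (Lg1 + 1) ^ 2))) C hα hβ hγ
    (by positivity) hC
  refine ⟨K, hK, ?_⟩
  intro dx dy f g x₀ y₀ v₀ hA hΔ hG hG'
  set s := iterate f g ⟨x₀, y₀, v₀, α₀, β₀, γ₀⟩ with hs
  have hs0 : s 0 = ⟨x₀, y₀, v₀, α₀, β₀, γ₀⟩ := rfl
  have hstep := iterate_succ hA.contDiff_g (f := f) ⟨x₀, y₀, v₀, α₀, β₀, γ₀⟩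
  simp only [← hs] at hstep
  have hpos := iterate_pos hA.contDiff_g (f := f) (s₀ := ⟨x₀, y₀, v₀, α₀, β₀, γ₀⟩)
    (by linarith) hβ hγ
  rw [← hs] at hpos
  let p : ℕ → E dy := fun t => gradY g (s t).x (s t).y
  let r : ℕ → E dy := fun t => gradVR f g (s t).x (s t).y (s t).v
  let d : ℕ → E dx := fun t => gradX f (s t).x (s t).y - mixedXY g (s t).x (s t).y (s t).v
  have hα2 : ∀ t, (s (t + 1)).α ^ 2 = (s t).α ^ 2 + ‖d t‖ ^ 2 := fun t => by
    rw [hstep]; exact Real.sq_sqrt (by positivity)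
  have hβ2 : ∀ t, (s (t + 1)).β ^ 2 = (s t).β ^ 2 + ‖p t‖ ^ 2 := fun t => by
    rw [hstep]; exact Real.sq_sqrt (by positivity)
  have hγ2 : ∀ t, (s (t + 1)).γ ^ 2 = (s t).γ ^ 2 + ‖r t‖ ^ 2 := fun t => by
    rw [hstep]; exact Real.sq_sqrt (by positivity)
  have hx : ∀ t, (s (t + 1)).x = (s t).x -
      (1 / ((s (t + 1)).α * max (s (t + 1)).β (s (t + 1)).γ)) • d t := fun t => by
    rw [hstep]; rfl
  have hy : ∀ t, (s (t + 1)).y = (s t).y - (1 / (s (t + 1)).β) • p t := fun t => by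
    rw [hstep]; rfl
  have hv : ∀ t, (s (t + 1)).v = (s t).v -
      (1 / max (s (t + 1)).β (s (t + 1)).γ) • r t := fun t => by
    rw [hstep]; rfl
  have hβmono : Monotone fun t => (s t).β :=
    accumulator_monotone (X := fun t => ‖p t‖ ^ 2) (fun t => (hpos t).2.1)
      (fun t => sq_nonneg _) hβ2
  have hβ0 : ∀ t, β₀ ≤ (s t).β := fun t => hβmono (Nat.zero_le t)
  have hφ : ∀ t, 0 < max (s t).β (s t).γ := fun t => lt_max_of_lt_left (hpos t).2.1
  -- The potentials U, V, F are ‖y - y*‖², ‖v - v*‖² and Φ, and S is the squared hypergradient norm.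
  refine H (fun t => (s t).α) (fun t => (s t).β) (fun t => (s t).γ) (fun t => ‖d t‖ ^ 2)
    (fun t => ‖p t‖ ^ 2) (fun t => ‖r t‖ ^ 2)
    (fun t => ‖gradient (Phi f g) (s t).x‖ ^ 2) (fun t => ‖(s t).y - yStar g (s t).x‖ ^ 2)
    (fun t => ‖(s t).v - vStar f g (s t).x‖ ^ 2) (fun t => Phi f g (s t).x) rfl rfl rfl
    (fun t => (hpos t).1) (fun t => (hpos t).2.1) (fun t => (hpos t).2.2)
    (fun t => sq_nonneg _) (fun t => sq_nonneg _) (fun t => sq_nonneg _) (fun t => sq_nonneg _)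
    hα2 hβ2 hγ2 ?_ ?_ ?_ ?_ ?_ (fun t => sq_nonneg _) (fun t => sq_nonneg _) ?_
  · intro t
    have h := hA.yStar_tracking hμ hβ (hpos (t + 1)).1 (hβ0 (t + 1))
      (le_max_left _ (s (t + 1)).γ) (s t).x (d t) (s t).y
    rw [hy, hx]
    refine h.trans ?_
    have := (hpos (t + 1)).1
    have := hφ (t + 1)
    gcongr
  · intro t
    have h := hA.vStar_tracking hμ hβ (hpos (t + 1)).1
      ((hβ0 (t + 1)).trans (le_max_left _ (s (t + 1)).γ)) (s t).x (d t) (s t).y (s t).v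
    rw [hv, hx]
    refine h.trans ?_
    have := (hpos (t + 1)).1
    have := hφ (t + 1)
    gcongr
  · intro t
    have h1 := (hpos (t + 1)).1
    have h2 := hφ (t + 1)
    have h := hA.Phi_descent hμ
      (τ := 1 / ((s (t + 1)).α * max (s (t + 1)).β (s (t + 1)).γ)) (by positivity)
      (s t).x (s t).y (s t).v
    rw [hx, ← mul_pow, div_eq_mul_one_div, div_eq_mul_one_div (_ + _),
      div_eq_mul_one_div (‖d t‖ ^ 2), ← one_div_pow]
    refine h.trans ?_
    gcongr
  · refine (hA.norm_sub_yStar_sq_le hμ _ _).trans (le_trans ?_ q₇)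
    rw [hC₇]
    gcongr
    exact hG
  · refine (hA.norm_sub_vStar_sq_le hμ _ (s 0).y _).trans (le_trans ?_ q₈)
    rw [hC₈]
    gcongr
    · exact hG'
    · exact hG
  · intro t
    have h1 : (⨅ x, Phi f g x) ≤ Phi f g (s t).x := ciInf_le hA.bddBelow _
    have h2 := le_abs_self Δ
    simp only [hs0]
    linarith

end Bilevel

/-! ### Iteration and query counts -/

theorem mainTheorem4 (μ : ℝ) (Lf0 Lf1 Lg1 Lg2 : ℝ≥0) (α₀ β₀ γ₀ Δ G : ℝ)
    (hμ : 0 < μ) (hα : 1 ≤ α₀) (hβ : 0 < β₀) (hγ : 0 < γ₀) :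
    ∃ C : ℝ, 0 < C ∧ ∃ ε₀ : ℝ, 0 < ε₀ ∧ ε₀ < 1 ∧
      ∀ ε : ℝ, 0 < ε → ε ≤ ε₀ →
        ∃ T : ℕ, 0 < T ∧ (T : ℝ) ≤ C * (1 / ε * Real.log (1 / ε) ^ 4) ∧
          ∀ (dx dy : ℕ) (f g : Bilevel.E dx → Bilevel.E dy → ℝ)
            (x₀ : Bilevel.E dx) (y₀ v₀ : Bilevel.E dy),
            Bilevel.Assumptions μ Lf0 Lf1 Lg1 Lg2 f g →
            Bilevel.Phi f g x₀ - (⨅ x, Bilevel.Phi f g x) ≤ Δ →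
            ‖Bilevel.gradY g x₀ y₀‖ ≤ G →
            ‖Bilevel.gradVR f g x₀ y₀ v₀‖ ≤ G →
            let s₀ : Bilevel.State dx dy := ⟨x₀, y₀, v₀, α₀, β₀, γ₀⟩
            (1 / (T : ℝ) * ∑ t ∈ Finset.range T,
                ‖gradient (Bilevel.Phi f g) (Bilevel.iterate f g s₀ t).x‖ ^ 2 ≤ ε) ∧
              (∃ t < T, Bilevel.IsAccurate f g ε (Bilevel.iterate f g s₀ t).x) ∧
              (Bilevel.gradCount f g s₀ T : ℝ) ≤ C * (1 / ε * Real.log (1 / ε) ^ 4) := by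
  obtain ⟨K, hK, H⟩ := Bilevel.exists_sum_sq_norm_gradient_Phi_le μ Lf0 Lf1 Lg1 Lg2 α₀ β₀ γ₀ Δ G
    hμ hα hβ hγ
  -- The 5 counts queries per iteration, and the 2 covers the ceiling and the extra iteration in
  -- `T`. The threshold 1/e makes log(1/ε) ≥ 1, so the fourth power only enlarges the bound.
  refine ⟨5 * (K + 2), by positivity, Real.exp (-1), Real.exp_pos _,
    Real.exp_lt_one_iff.mpr (by norm_num), ?_⟩
  intro ε hε hε₀
  have hε1 : ε ≤ 1 := hε₀.trans (Real.exp_le_one_iff.mpr (by norm_num))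
  have hlog : 1 ≤ Real.log (1 / ε) ^ 4 := by
    refine one_le_pow₀ ?_
    rw [one_div, Real.log_inv]
    have := Real.log_le_log hε hε₀
    rw [Real.log_exp] at this
    linarith
  set T := ⌈K / ε⌉₊ + 1 with hT
  have hT1 : K / ε ≤ T := by
    rw [hT]; push_cast
    linarith [Nat.le_ceil (K / ε)]
  have hT2 : (5 : ℝ) * T ≤ 5 * (K + 2) * (1 / ε * Real.log (1 / ε) ^ 4) := by
    have h1 : (T : ℝ) ≤ K / ε + 2 := by
      rw [hT]; push_cast
      linarith [Nat.ceil_lt_add_one (show 0 ≤ K / ε by positivity)]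
    have h2 : K / ε + 2 ≤ (K + 2) * (1 / ε) := by
      have : 1 ≤ 1 / ε := by rw [le_div_iff₀ hε]; linarith
      have : K / ε = K * (1 / ε) := by ring
      linarith
    calc (5 : ℝ) * T ≤ 5 * ((K + 2) * (1 / ε)) := by linarith
      _ ≤ 5 * ((K + 2) * (1 / ε)) * Real.log (1 / ε) ^ 4 :=
        le_mul_of_one_le_right (by positivity) hlog
      _ = _ := by ring
  have hT0 : (0 : ℝ) < T := by positivity
  refine ⟨T, Nat.succ_pos _, by linarith, ?_⟩
  intro dx dy f g x₀ y₀ v₀ hA hΔ hG hG'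
  have hsum := H dx dy f g x₀ y₀ v₀ hA hΔ hG hG' T
  have hKT : K ≤ T * ε := by rwa [div_le_iff₀ hε] at hT1
  refine ⟨?_, ?_, ?_⟩
  · rw [one_div, inv_mul_le_iff₀ hT0]
    exact hsum.trans hKT
  -- Φ is differentiable everywhere, so a non-accurate iterate has squared gradient above ε. If all
  -- were such, the sum would exceed Tε ≥ K.
  · by_contra! hcon
    have h1 : ∀ t ∈ Finset.range T, ε <
        ‖gradient (Bilevel.Phi f g) (Bilevel.iterate f g ⟨x₀, y₀, v₀, α₀, β₀, γ₀⟩ t).x‖ ^ 2 := by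
      intro t ht
      by_contra! h2
      exact hcon t (Finset.mem_range.mp ht) ⟨(hA.hasGradientAt_Phi hμ _).differentiableAt, h2⟩
    have h2 := Finset.sum_lt_sum_of_nonempty (Finset.nonempty_range_iff.mpr (Nat.succ_ne_zero _)) h1
    rw [Finset.sum_const, Finset.card_range, nsmul_eq_mul] at h2
    linarith
  · rw [Bilevel.gradCount_eq]
    push_cast
    exact hT2
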